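/- Let $q=e^{2\pi i\tau}$, $y=e^{2\pi i z}$, $y^{1/2}=e^{\pi i z}$ with $(\tau,z)\in\mathfrak H\times\mathbb C$, and put $$\phi_{-2,1}(\tau,z)=(y^{\frac12}-y^{-\frac12})^2\prod_{n\ge1}\frac{(1-q^ny)^2(1-q^ny^{-1})^2}{(1-q^n)^4},\qquad \Delta(\tau)=q\prod_{n\ge1}(1-q^n)^{24}.$$ Let $r$ be a prime and let $L$ be an even unimodular lattice of signature $(3,19)$, with pairing $(a,b)\mapsto ab$; for a K3 surface $S$ this is $L=H^2(S,\mathbb Z)$ with the cup product. For $c_1\in L$ let $\delta_{c_1,0}=1$ if $c_1\in rL$ and $0$ otherwise, and put $$F^{\mathrm{inst}}_{c_1}(\tau,z)=\frac1r\sum_{m=0}^{r-1}e^{\frac{\pi i(r-1)}{r}mc_1^2}\frac{(y^{\frac12}-y^{-\frac12})^2}{\phi_{-2,1}(\frac{\tau+m}{r},z)\,\Delta(\frac{\tau+m}{r})},\qquad F^{\mathrm{mono}}_{c_1}(\tau,z)=\frac{(y^{\frac12}-y^{-\frac12})^2}{\phi_{-2,1}(r\tau,rz)\,\Delta(r\tau)}\,\delta_{c_1,0},$$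 and $F_{c_1}=F^{\mathrm{inst}}_{c_1}+F^{\mathrm{mono}}_{c_1}$. Then: (1) $F_{c_1}$ only depends on $[c_1]\in L/rL$, is meromorphic on $\mathfrak H\times\mathbb C$, and satisfies $$F_{c_1}(\tau+1,z)=e^{-\frac{\pi i(r-1)}{r}c_1^2}F_{c_1}(\tau,z),$$ $$\left.\frac{F_{c_1}(\tau,z)}{(y^{\frac12}-y^{-\frac12})^2}\right|_{(-1/\tau,z/\tau)}=r^{-11}\tau^{-10}e^{-\frac{2\pi i z^2}{\tau}r}\sum_{[a]\in L/rL}e^{\frac{2\pi i}{r}c_1a}\,\frac{F_a(\tau,z)}{(y^{\frac12}-y^{-\frac12})^2},$$ both as identities of meromorphic functions and pointwise at all $(\tau,z)$ with $rz\notin\mathbb Z+\mathbb Z\tau$. These are the case $\chi=2$, $K^2=0$, $e=24$ of the refined modular transformations $$Z_{c_1}(\tau+1,z)=(-1)^{r\chi}e^{\frac{\pi ir}{12}K^2}e^{-\frac{\pi i(r-1)}{r}c_1^2}Z_{c_1}(\tau,z),$$ $$\left.\frac{Z_{c_1}(\tau,z)}{(y^{\frac12}-y^{-\frac12})^{\chi}}\right|_{(-1/\tau,z/\tau)}=(-1)^{r\chi}r^{1-\frac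 e2}i^{-\frac{K^2}2}\tau^{-5\chi+\frac{K^2}2}e^{\frac{2\pi iz^2}{\tau}\left(-\frac r2\chi-\frac{(r-1)^2}{4}K^2\right)}\sum_{[a]}e^{\frac{2\pi i}{r}c_1a}\frac{Z_a(\tau,z)}{(y^{\frac12}-y^{-\frac12})^{\chi}}.$$ (2) Let $Z^{\mathrm{inst}}_{c_1}(q,y)$ and $Z^{\mathrm{mono}}_{c_1}(q,y)$ ($c_1\in L$) be any formal Laurent series in $q^{1/(24r)}$ with coefficients in $\mathbb C(y^{1/2})$ (for instance the instanton and monopole parts of the generating series of $y$-refined $\mathrm{SU}(r)$ Vafa–Witten invariants of a polarized K3 surface) which are the Fourier expansions of $F^{\mathrm{inst}}_{c_1}$ and $F^{\mathrm{mono}}_{c_1}$. Then $Z_{c_1}=Z^{\mathrm{inst}}_{c_1}+Z^{\mathrm{mono}}_{c_1}$ only depends on $[c_1]\in L/rL$ and is the Fourier expansion of a meromorphic function $Z_{c_1}(\tau,z)$ on $\mathfrak H\times\mathbb C$, and these functions satisfy the refined modular transformations with $\chi=2$, $K^2=0$, $e=24$. Here a series is the Fourier expansion of $F(\tau,z)$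 if for all $z$ outside a closed discrete subset of $\mathbb C$ its coefficients have no pole at $y^{1/2}=e^{\pi iz}$ and it converges to $F(\tau,z)$ whenever $\operatorname{Im}\tau$ is large enough (depending on $z$). -/

import Mathlib

noncomputable section

namespace RefinedVW

open Complex

/-! ### Jacobi forms and the discriminant -/

/-- `y^{1/2} - y^{-1/2}` for `y = e^{2πiz}`, where `y^{1/2} = e^{πiz}`. -/
def yDiff (z : ℂ) : ℂ := exp (Real.pi * I * z) - exp (-(Real.pi * I * z))

/-- The weak Jacobi form `φ_{-2,1}(τ,z)` of weight `-2` and index `1`,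
`(y^{1/2} - y^{-1/2})² ∏_{n ≥ 1} (1 - qⁿy)² (1 - qⁿy⁻¹)² / (1 - qⁿ)⁴`,
with `q = e^{2πiτ}`, `y = e^{2πiz}`. -/
def phiNegTwoOne (τ z : ℂ) : ℂ :=
  yDiff z ^ 2 * ∏' n : ℕ,
    ((1 - exp (2 * Real.pi * I * τ) ^ (n + 1) * exp (2 * Real.pi * I * z)) ^ 2 *
      (1 - exp (2 * Real.pi * I * τ) ^ (n + 1) * exp (-(2 * Real.pi * I * z))) ^ 2 /
      (1 - exp (2 * Real.pi * I * τ) ^ (n + 1)) ^ 4)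

/-- The discriminant `Δ(τ) = η(τ)^24 = q ∏_{n ≥ 1} (1 - qⁿ)^24`. On the upper half plane this is
`ModularForm.discriminant`. -/
def disc (τ : ℂ) : ℂ := ModularForm.eta τ ^ 24

/-! ### Meromorphic functions on `ℍ × ℂ` -/

/-- The domain `ℍ × ℂ`, as an open subset of `ℂ × ℂ`. -/
def dom : Set (ℂ × ℂ) := {p | 0 < p.1.im}

/-- `F` represents a meromorphic function on `ℍ × ℂ`: locally it is a quotient `g / h` of
holomorphic functions, with `h` not vanishing identically on any nonempty open set. The values of
`F` where `h = 0` are irrelevant. -/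
def IsMeromorphic (F : ℂ → ℂ → ℂ) : Prop :=
  ∀ p ∈ dom, ∃ U : Set (ℂ × ℂ), IsOpen U ∧ p ∈ U ∧ U ⊆ dom ∧
    ∃ g h : ℂ × ℂ → ℂ, DifferentiableOn ℂ g U ∧ DifferentiableOn ℂ h U ∧
      U ⊆ closure {x ∈ U | h x ≠ 0} ∧ ∀ x ∈ U, h x ≠ 0 → F x.1 x.2 = g x / h x

/-- Equality of (representatives of) meromorphic functions on `ℍ × ℂ`: they agree on a dense open
subset of `ℍ × ℂ`. -/
def MerEq (F G : ℂ → ℂ → ℂ) : Prop :=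
  ∃ U : Set (ℂ × ℂ), IsOpen U ∧ U ⊆ dom ∧ dom ⊆ closure U ∧ ∀ x ∈ U, F x.1 x.2 = G x.1 x.2

/-! ### Generating series and Fourier expansions -/

/-- Formal Laurent series in a root of `q`, whose coefficients are rational functions in
`y^{1/2}`. -/
abbrev QYSeries : Type := LaurentSeries (RatFunc ℂ)

/-- The formal series `∑ₙ aₙ(y^{1/2}) q^{n/N}` is the Fourier expansion of `F(τ,z)`, with
`q = e^{2πiτ}`, `y^{1/2} = e^{πiz}`: for all `z` outside a closed discrete set, no coefficient has
a pole at `y^{1/2}` and the series converges to `F(τ,z)` whenever `Im τ` is large enough. -/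
def IsFourierExpansion (N : ℕ) (Z : QYSeries) (F : ℂ → ℂ → ℂ) : Prop :=
  ∀ᶠ z in Filter.codiscrete ℂ,
    (∀ n : ℤ, (Z.coeff n).denom.eval (exp (Real.pi * I * z)) ≠ 0) ∧
    ∃ M : ℝ, 0 ≤ M ∧ ∀ τ : ℂ, M < τ.im →
    HasSum (fun n : ℤ =>
      RatFunc.eval (RingHom.id ℂ) (exp (Real.pi * I * z)) (Z.coeff n) *
        exp (2 * Real.pi * I * τ * n / N)) (F τ z)

/-! ### Lattices -/

section Lattice

variable {L : Type*} [AddCommGroup L]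

/-- The sublattice `rL` of `L`. -/
def multiples (L : Type*) [AddCommGroup L] (r : ℕ) : Submodule ℤ L :=
  LinearMap.range (LinearMap.lsmul ℤ L (r : ℤ))

/-- `(L, B)` is a K3 lattice: an even unimodular lattice of signature `(3,19)`. For a K3 surface
`S` the cohomology group `H²(S,ℤ)` with the cup product pairing is such a lattice. -/
structure IsK3Lattice [Module.Free ℤ L] [Module.Finite ℤ L] (B : LinearMap.BilinForm ℤ L) :
    Prop where
  symm : ∀ x y : L, B x y = B y x
  even : ∀ x : L, Even (B x x)
  unimodular : Function.Bijective (fun x : L => B x)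
  sigPos_eq : sigPos (B.baseChange ℝ).toQuadraticMap = 3
  sigNeg_eq : sigNeg (B.baseChange ℝ).toQuadraticMap = 19

/-! ### The refined modular transformations

Here `χ = χ(𝒪_S)`, `K2 = K_S²`, `e = e(S)` are the numerical invariants of a surface `S`, and
`(L, B)` is the lattice `H²(S,ℤ)`. -/

/-- The factor picked up under `τ ↦ τ + 1`, where `c = c₁²`. -/
def tFactor (r : ℕ) (χ K2 c : ℤ) : ℂ :=
  (-1) ^ (r * χ) * exp (Real.pi * I * r / 12 * K2) * exp (-(Real.pi * I * (r - 1) / r * c))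

/-- The factor picked up under `(τ, z) ↦ (-1/τ, z/τ)`. -/
def sFactor (r : ℕ) (χ K2 e : ℤ) (τ z : ℂ) : ℂ :=
  (-1) ^ (r * χ) * (r : ℂ) ^ (1 - (e : ℂ) / 2) * I ^ (-(K2 : ℂ) / 2) *
    τ ^ (-5 * (χ : ℂ) + (K2 : ℂ) / 2) *
    exp (2 * Real.pi * I * z ^ 2 / τ * (-((r : ℂ) / 2) * χ - ((r : ℂ) - 1) ^ 2 / 4 * K2))

/-- The family `F c₁`, `c₁ ∈ L`, consists of meromorphic functions on `ℍ × ℂ` which satisfy the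
refined modular transformations. The sum runs over `[a] ∈ L / rL`. -/
structure RefinedModular (r : ℕ) (χ K2 e : ℤ) (B : LinearMap.BilinForm ℤ L)
    (F : L → ℂ → ℂ → ℂ) : Prop where
  meromorphic : ∀ c₁ : L, IsMeromorphic (F c₁)
  trans_T : ∀ c₁ : L, MerEq (fun τ z => F c₁ (τ + 1) z)
    (fun τ z => tFactor r χ K2 (B c₁ c₁) * F c₁ τ z)
  trans_S : ∀ c₁ : L, MerEq (fun τ z => F c₁ (-1 / τ) (z / τ) / yDiff (z / τ) ^ χ)
    (fun τ z => sFactor r χ K2 e τ z *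
      ∑ᶠ a : L ⧸ multiples L r,
        exp (2 * Real.pi * I / r * B c₁ a.out) * (F a.out τ z / yDiff z ^ χ))

/-- The refined modularity conjecture for generating series `Z c₁`, `c₁ ∈ L`, in powers of
`q^{1/(24r)}` (the exponents `-χ/(2r) + rK²/24 + vd/(2r)` all lie in `(1/(24r))ℤ`): `Z c₁` only
depends on the class of `c₁` in `L / rL` and is the Fourier expansion of a meromorphic function on
`ℍ × ℂ`; these functions satisfy the refined modular transformations. -/
def RefinedModularityConj (r : ℕ) (χ K2 e : ℤ) (B : LinearMap.BilinForm ℤ L)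
    (Z : L → QYSeries) : Prop :=
  (∀ c₁ c₁' : L, c₁ - c₁' ∈ multiples L r → Z c₁ = Z c₁') ∧
    ∃ F : L → ℂ → ℂ → ℂ, (∀ c₁ : L, IsFourierExpansion (24 * r) (Z c₁) (F c₁)) ∧
      RefinedModular r χ K2 e B F

/-! ### The formulas for K3 surfaces -/

/-- Instanton part:
`(1/r) ∑_{m=0}^{r-1} e^{πi(r-1)m c₁²/r} (y^{1/2} - y^{-1/2})² / (φ_{-2,1} Δ)` at
`((τ+m)/r, z)`. -/
def k3Inst (r : ℕ) (B : LinearMap.BilinForm ℤ L) (c₁ : L) (τ z : ℂ) : ℂ :=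
  1 / r * ∑ m ∈ Finset.range r, exp (I * Real.pi * (r - 1) / r * m * B c₁ c₁) *
    (yDiff z ^ 2 / (phiNegTwoOne ((τ + m) / r) z * disc ((τ + m) / r)))

open Classical in
/-- Monopole part: `δ_{c₁,0} (y^{1/2} - y^{-1/2})² / (φ_{-2,1}(rτ,rz) Δ(rτ))`, where `δ_{c₁,0}` is
`1` if `c₁ ∈ rL` and `0` otherwise. -/
def k3Mono (r : ℕ) (c₁ : L) (τ z : ℂ) : ℂ :=
  yDiff z ^ 2 / (phiNegTwoOne (r * τ) (r * z) * disc (r * τ)) *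
    (if c₁ ∈ multiples L r then 1 else 0)

/-- Sum of the instanton part and the monopole part. -/
def k3Total (r : ℕ) (B : LinearMap.BilinForm ℤ L) (c₁ : L) (τ z : ℂ) : ℂ :=
  k3Inst r B c₁ τ z + k3Mono r c₁ τ z

/-- The K3 conjecture for the instanton and monopole generating series `Zinst c₁`, `Zmono c₁`
(Laurent series in `q^{1/(24r)}`): they are the Fourier expansions of the formulas above. -/
def K3Conj (r : ℕ) (B : LinearMap.BilinForm ℤ L) (Zinst Zmono : L → QYSeries) : Prop :=
  ∀ c₁ : L, IsFourierExpansion (24 * r) (Zinst c₁) (k3Inst r B c₁) ∧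
    IsFourierExpansion (24 * r) (Zmono c₁) (k3Mono r c₁)

end Lattice

end RefinedVW

end

namespace RefinedVW
open Complex Filter Topology

/-! ### The Jacobi triple product -/

/-! Write Φ = φ_{-2,1}Δ, Q(x) = x²/2 and e(t) = exp(2πit). The Jacobi triple product identifies Φ
with θ₁²η¹⁸, so the functional equations of `jacobiTheta₂` and η make Φ a Jacobi form of weight 10
and index 1 for SL(2, ℤ) (`phiDisc_moebius`). Divided by (y^{1/2} - y^{-1/2})², the function F_c
becomes `k3Reduced`: the terms e(-mQ(c)/r) / (rΦ((τ+m)/r, z)) for m mod r, plus δ_{c,0}/Φ(rτ, rz).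
These r + 1 functions are the Hecke-type translates of 1/Φ at the prime r, and SL(2, ℤ) permutes
them up to automorphy factors: T shifts m by one, while S pairs m ≠ 0 with t = -1/m and exchanges m
= 0 with the monopole term.

The S-transformation then amounts to computing the finite Fourier transform over L/rL of the
coefficients. The phase with t ≠ 0 is a Gauss sum: completing the square gives Σ_a e((ca - tQ(a))/r)
= r¹¹ e(-mQ(c)/r) with mt = -1 (`finsum_stdAddChar_bilin_mul_halfForm`). For t = 0 orthogonality of
characters gives r²²δ_{c,0}, and δ transforms to the constant 1. Together with the factors r^{±10}
picked up when m = 0 and the monopole term are exchanged, every term acquires the same r^{-11}.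

The lattice enters the Gauss sum only through evenness, rank 22 and discriminant -1, the last two
coming from unimodularity and signature (3,19). For odd r, diagonalising over the field yields
χ(-1)(χ(-1)r)¹¹ = r¹¹. For r = 2 the form is lifted to ℤ/8 and split into binary even blocks, with
sign χ₈(-1) = 1.

For the formal series, a Fourier expansion is unique (`IsFourierExpansion.unique`), so dependence on
the class of c₁ alone passes from functions to series. -/

/-- The Gaussian binomial coefficients, evaluated at `q`. -/
def gaussBinom (q : ℂ) : ℕ → ℕ → ℂ
  | _, 0 => 1
  | 0, _ + 1 => 0
  | n + 1, k + 1 => gaussBinom q n k + q ^ (k + 1) * gaussBinom q n (k + 1)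

lemma gaussBinom_zero_right (q : ℂ) (n : ℕ) : gaussBinom q n 0 = 1 := by
  cases n <;> rfl

lemma gaussBinom_eq_zero_of_lt (q : ℂ) {n k : ℕ} (h : n < k) : gaussBinom q n k = 0 := by
  induction n generalizing k with
  | zero =>
    obtain ⟨k, rfl⟩ := Nat.exists_eq_succ_of_ne_zero h.ne'
    rfl
  | succ n ih =>
    obtain ⟨k, rfl⟩ := Nat.exists_eq_succ_of_ne_zero (Nat.ne_zero_of_lt h)
    simp only [gaussBinom]
    rw [ih (by omega), ih (by omega)]
    simp

/-- The finite `q`-Pochhammer symbol `∏_{k=1}^n (1 - q^k)`. -/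
def qPochhammer (q : ℂ) (n : ℕ) : ℂ := ∏ k ∈ Finset.range n, (1 - q ^ (k + 1))

/-- The multiplied-out closed form follows from the Pascal recursion for every q, roots of unity
included. -/
lemma gaussBinom_mul_qPochhammer (q : ℂ) (m k : ℕ) :
    gaussBinom q (m + k) k * (qPochhammer q k * qPochhammer q m) = qPochhammer q (m + k) := by
  suffices h : ∀ n m k, m + k = n →
      gaussBinom q n k * (qPochhammer q k * qPochhammer q m) = qPochhammer q n from h _ _ _ rfl
  intro n
  induction n with
  | zero =>
    intro m k h
    obtain ⟨rfl, rfl⟩ : m = 0 ∧ k = 0 := by omega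
    simp [gaussBinom, qPochhammer]
  | succ n ih =>
    intro m k h
    have hs : ∀ j, qPochhammer q (j + 1) = qPochhammer q j * (1 - q ^ (j + 1)) := fun j ↦
      Finset.prod_range_succ _ _
    rcases k with _ | k
    · obtain rfl : m = n + 1 := by omega
      simp [gaussBinom, qPochhammer]
    · rcases m with _ | m
      · obtain rfl : k = n := by omega
        have := ih 0 k (by omega)
        simp only [gaussBinom]
        rw [gaussBinom_eq_zero_of_lt q (Nat.lt_succ_self k), hs]
        linear_combination (1 - q ^ (k + 1)) * this
      · have h1 := ih (m + 1) k (by omega)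
        have h2 := ih m (k + 1) (by omega)
        obtain rfl : n = m + 1 + k := by omega
        simp only [gaussBinom]
        rw [hs (m + 1 + k)]
        rw [hs] at h1 h2 ⊢
        rw [hs]
        -- The q-Pascal identity behind this is (1 - q^{k+1}) + q^{k+1}(1 - q^{m+1}) = 1 -
        -- q^{m+k+2}.
        linear_combination (1 - q ^ (k + 1)) * h1 + q ^ (k + 1) * (1 - q ^ (m + 1)) * h2

/-- The `q`-binomial theorem, with `q = p²`. -/
lemma prod_one_add_mul_pow (p x : ℂ) (n : ℕ) :
    ∏ k ∈ Finset.range n, (1 + x * p ^ (2 * k + 1)) =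
      ∑ j ∈ Finset.range (n + 1), p ^ (j ^ 2) * gaussBinom (p ^ 2) n j * x ^ j := by
  induction n generalizing x with
  | zero => simp [gaussBinom]
  | succ n ih =>
    have h1 : ∏ k ∈ Finset.range n, (1 + x * p ^ (2 * (k + 1) + 1)) =
        ∏ k ∈ Finset.range n, (1 + (x * p ^ 2) * p ^ (2 * k + 1)) :=
      Finset.prod_congr rfl fun k _ ↦ by ring
    rw [Finset.prod_range_succ', h1, ih, Finset.sum_range_succ' _ (n + 1)]
    have h2 : ∀ j, p ^ ((j + 1) ^ 2) * gaussBinom (p ^ 2) (n + 1) (j + 1) * x ^ (j + 1) =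
        x * p * (p ^ (j ^ 2) * gaussBinom (p ^ 2) n j * (x * p ^ 2) ^ j) +
          p ^ ((j + 1) ^ 2) * gaussBinom (p ^ 2) n (j + 1) * (x * p ^ 2) ^ (j + 1) := fun j ↦ by
      simp only [gaussBinom]; ring
    simp only [h2, Finset.sum_add_distrib, ← Finset.mul_sum, gaussBinom_zero_right]
    have h3 := Finset.sum_range_succ'
      (fun j ↦ p ^ (j ^ 2) * gaussBinom (p ^ 2) n j * (x * p ^ 2) ^ j) (n + 1)
    rw [Finset.sum_range_succ, gaussBinom_eq_zero_of_lt _ (Nat.lt_succ_self n)] at h3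
    simp only [gaussBinom_zero_right] at h3
    linear_combination h3

/-- This is the q-binomial theorem of length 2n at x = s p^{-2n}, which centres the exponents: the
first n factors, reversed, become the s⁻¹ factors after extracting s^n p^{-n²}. -/
lemma prod_one_add_mul_pow_mul_symm {p s : ℂ} (hp : p ≠ 0) (hs : s ≠ 0) (n : ℕ) :
    (∏ k ∈ Finset.range n, (1 + s * p ^ (2 * k + 1))) *
        ∏ k ∈ Finset.range n, (1 + s⁻¹ * p ^ (2 * k + 1)) =
      ∑ j ∈ Finset.range (2 * n + 1), p ^ (((j : ℤ) - n) ^ 2) * s ^ ((j : ℤ) - n) *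
        gaussBinom (p ^ 2) (2 * n) j := by
  have h := prod_one_add_mul_pow p (s * p ^ (-(2 * n : ℤ))) (2 * n)
  have h1 : ∏ k ∈ Finset.range (2 * n), (1 + s * p ^ (-(2 * n : ℤ)) * p ^ (2 * k + 1)) =
      (∏ k ∈ Finset.range n, (s * p ^ (-(2 * k + 1 : ℤ)) * (1 + s⁻¹ * p ^ (2 * k + 1)))) *
        ∏ k ∈ Finset.range n, (1 + s * p ^ (2 * k + 1)) := by
    rw [two_mul, Finset.prod_range_add]
    congr 1
    · rw [← Finset.prod_range_reflect]
      refine Finset.prod_congr rfl fun k hk ↦ ?_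
      have hk := Finset.mem_range.mp hk
      have e1 : p ^ (-(2 * n : ℤ)) * p ^ (2 * (n - 1 - k) + 1) = p ^ (-(2 * k + 1 : ℤ)) := by
        rw [← zpow_natCast, ← zpow_add₀ hp]
        congr 1
        push_cast [Nat.sub_sub, Nat.cast_sub (show 1 + k ≤ n by omega)]
        ring
      have e2 : p ^ (-(2 * k + 1 : ℤ)) * p ^ (2 * k + 1) = 1 := by
        rw [← zpow_natCast, ← zpow_add₀ hp]
        push_cast
        rw [neg_add_cancel, zpow_zero]
      have e3 := mul_inv_cancel₀ hs
      linear_combination s * e1 - s * s⁻¹ * e2 - e3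
    · refine Finset.prod_congr rfl fun k _ ↦ ?_
      have e1 : p ^ (-(2 * n : ℤ)) * p ^ (2 * (n + k) + 1) = p ^ (2 * k + 1) := by
        rw [← zpow_natCast, ← zpow_add₀ hp, ← zpow_natCast]
        congr 1
        push_cast
        ring
      linear_combination s * e1
  have h2 : ∀ m : ℕ, ∏ k ∈ Finset.range m, (s * p ^ (-(2 * k + 1 : ℤ))) =
      s ^ (m : ℤ) * p ^ (-(m ^ 2 : ℤ)) := fun m ↦ by
    induction m with
    | zero => simp
    | succ m ih =>
      rw [Finset.prod_range_succ, ih]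
      have : p ^ (-(((m + 1 : ℕ) : ℤ) ^ 2)) = p ^ (-(m ^ 2 : ℤ)) * p ^ (-(2 * m + 1 : ℤ)) := by
        rw [← zpow_add₀ hp]
        congr 1
        push_cast
        ring
      rw [this]
      push_cast
      rw [zpow_add_one₀ hs]
      ring
  rw [h1, Finset.prod_mul_distrib, h2] at h
  have h3 : s ^ (-n : ℤ) * p ^ (n ^ 2 : ℤ) * (s ^ (n : ℤ) * p ^ (-(n ^ 2 : ℤ))) = 1 := by
    rw [mul_mul_mul_comm, ← zpow_add₀ hs, ← zpow_add₀ hp]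
    simp
  have h4 : (∏ k ∈ Finset.range n, (1 + s * p ^ (2 * k + 1))) *
        ∏ k ∈ Finset.range n, (1 + s⁻¹ * p ^ (2 * k + 1)) = s ^ (-n : ℤ) * p ^ (n ^ 2 : ℤ) *
      ∑ j ∈ Finset.range (2 * n + 1),
        p ^ (j ^ 2) * gaussBinom (p ^ 2) (2 * n) j * (s * p ^ (-(2 * n : ℤ))) ^ j := by
    rw [← h]
    linear_combination (-(∏ k ∈ Finset.range n, (1 + s * p ^ (2 * k + 1))) *
        ∏ k ∈ Finset.range n, (1 + s⁻¹ * p ^ (2 * k + 1))) * h3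
  rw [h4, Finset.mul_sum]
  refine Finset.sum_congr rfl fun j _ ↦ ?_
  have e1 : p ^ (((j : ℤ) - n) ^ 2) = p ^ (n ^ 2 : ℤ) * p ^ (j ^ 2) * (p ^ (-(2 * n : ℤ))) ^ j := by
    rw [← zpow_natCast p (j ^ 2), ← zpow_natCast (p ^ (_ : ℤ)) j, ← zpow_mul, ← zpow_add₀ hp,
      ← zpow_add₀ hp]
    congr 1
    push_cast
    ring
  have e2 : s ^ ((j : ℤ) - n) = s ^ (-n : ℤ) * s ^ j := by
    rw [← zpow_natCast s j, ← zpow_add₀ hs]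
    congr 1
    ring
  rw [e1, e2, mul_pow]
  ring

lemma tendsto_qPochhammer {q : ℂ} (hq : ‖q‖ < 1) :
    Tendsto (qPochhammer q) atTop (𝓝 (∏' k : ℕ, (1 - q ^ (k + 1)))) :=
  (ModularForm.multipliable_one_sub_pow hq).hasProd.tendsto_prod_nat

lemma one_sub_pow_ne_zero {q : ℂ} (hq : ‖q‖ < 1) (k : ℕ) : 1 - q ^ (k + 1) ≠ 0 := by
  intro h
  have h1 : ‖q ^ (k + 1)‖ = 1 := by rw [← sub_eq_zero.mp h, norm_one]
  rw [norm_pow] at h1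
  exact (pow_lt_one₀ (norm_nonneg q) hq k.succ_ne_zero).ne h1

lemma qPochhammer_ne_zero {q : ℂ} (hq : ‖q‖ < 1) (n : ℕ) : qPochhammer q n ≠ 0 :=
  Finset.prod_ne_zero_iff.mpr fun k _ ↦ one_sub_pow_ne_zero hq k

lemma tprod_one_sub_mul_pow_ne_zero {q c : ℂ} (hq : ‖q‖ < 1)
    (hc : ∀ k : ℕ, 1 - q ^ (k + 1) * c ≠ 0) : ∏' k : ℕ, (1 - q ^ (k + 1) * c) ≠ 0 := by
  simp_rw [sub_eq_add_neg] at hc ⊢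
  refine tprod_one_add_ne_zero_of_summable hc ?_
  simp only [norm_neg, norm_mul, norm_pow]
  exact ((summable_nat_add_iff 1).mpr
    (summable_geometric_of_lt_one (norm_nonneg q) hq)).mul_right _

lemma multipliable_one_sub_mul_pow {q : ℂ} (hq : ‖q‖ < 1) (c : ℂ) :
    Multipliable fun k : ℕ ↦ 1 - q ^ (k + 1) * c := by
  simp_rw [sub_eq_add_neg]
  refine multipliable_one_add_of_summable ?_
  simp only [norm_neg, norm_mul, norm_pow]
  exact ((summable_nat_add_iff 1).mpr
    (summable_geometric_of_lt_one (norm_nonneg q) hq)).mul_right _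

lemma tprod_one_sub_pow_ne_zero {q : ℂ} (hq : ‖q‖ < 1) : ∏' k : ℕ, (1 - q ^ (k + 1)) ≠ 0 := by
  simpa using tprod_one_sub_mul_pow_ne_zero (c := 1) hq
    (by simpa using one_sub_pow_ne_zero hq)

lemma gaussBinom_eq_div {q : ℂ} (hq : ‖q‖ < 1) {n k : ℕ} (h : k ≤ n) :
    gaussBinom q n k = qPochhammer q n / (qPochhammer q k * qPochhammer q (n - k)) := by
  rw [eq_div_iff (mul_ne_zero (qPochhammer_ne_zero hq _) (qPochhammer_ne_zero hq _))]
  have := gaussBinom_mul_qPochhammer q (n - k) k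
  rwa [Nat.sub_add_cancel h] at this

/-- The q-Pochhammer symbols and their inverses both converge, hence are bounded. The uniform bound
feeds dominated convergence in the triple product. -/
lemma exists_norm_gaussBinom_le {q : ℂ} (hq : ‖q‖ < 1) : ∃ C, ∀ n k, ‖gaussBinom q n k‖ ≤ C := by
  have ht := tendsto_qPochhammer hq
  obtain ⟨C₁, h₁⟩ := ht.norm.bddAbove_range
  obtain ⟨C₂, h₂⟩ := (ht.inv₀ (tprod_one_sub_pow_ne_zero hq)).norm.bddAbove_range
  have b₁ : ∀ n, ‖qPochhammer q n‖ ≤ C₁ := fun n ↦ h₁ ⟨n, rfl⟩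
  have b₂ : ∀ n, ‖(qPochhammer q n)⁻¹‖ ≤ C₂ := fun n ↦ h₂ ⟨n, rfl⟩
  have p₁ := (norm_nonneg _).trans (b₁ 0)
  have p₂ := (norm_nonneg _).trans (b₂ 0)
  refine ⟨C₁ * (C₂ * C₂), fun n k ↦ ?_⟩
  rcases lt_or_ge n k with h | h
  · rw [gaussBinom_eq_zero_of_lt q h, norm_zero]
    positivity
  · rw [gaussBinom_eq_div hq h, div_eq_mul_inv, mul_inv, norm_mul, norm_mul]
    exact mul_le_mul (b₁ _) (mul_le_mul (b₂ _) (b₂ _) (norm_nonneg _) p₂) (by positivity) p₁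

lemma tendsto_gaussBinom_central {q : ℂ} (hq : ‖q‖ < 1) (m : ℤ) :
    Tendsto (fun n : ℕ ↦ gaussBinom q (2 * n) (m + n).toNat) atTop
      (𝓝 (∏' k : ℕ, (1 - q ^ (k + 1)))⁻¹) := by
  have ht := tendsto_qPochhammer hq
  have h0 := tprod_one_sub_pow_ne_zero hq
  have t1 : Tendsto (fun n : ℕ ↦ 2 * n) atTop atTop :=
    tendsto_atTop_mono (fun n ↦ Nat.le_mul_of_pos_left n two_pos) tendsto_id
  have t2 : ∀ m : ℤ, Tendsto (fun n : ℕ ↦ (m + n).toNat) atTop atTop := fun m ↦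
    tendsto_atTop.mpr fun b ↦ by
      filter_upwards [eventually_ge_atTop (b + m.natAbs)] with n hn
      omega
  have t3 : Tendsto (fun n : ℕ ↦ 2 * n - (m + n).toNat) atTop atTop :=
    tendsto_atTop.mpr fun b ↦ by
      filter_upwards [eventually_ge_atTop (b + m.natAbs)] with n hn
      omega
  have := (ht.comp t1).div ((ht.comp (t2 m)).mul (ht.comp t3)) (mul_ne_zero h0 h0)
  rw [div_mul_cancel_left₀ h0] at this
  refine this.congr' ?_
  filter_upwards [eventually_ge_atTop m.natAbs] with n hn
  rw [gaussBinom_eq_div hq (by omega)]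
  rfl

/-- The **Jacobi triple product** identity. -/
theorem jacobi_triple_product {p s : ℂ} (hp : p ≠ 0) (hp1 : ‖p‖ < 1) (hs : s ≠ 0)
    (hsum : Summable fun n : ℤ ↦ ‖p ^ (n ^ 2) * s ^ n‖) :
    ∑' n : ℤ, p ^ (n ^ 2) * s ^ n =
      (∏' k : ℕ, (1 - (p ^ 2) ^ (k + 1))) * ((∏' k : ℕ, (1 + s * p ^ (2 * k + 1))) *
        ∏' k : ℕ, (1 + s⁻¹ * p ^ (2 * k + 1))) := by
  have hq : ‖p ^ 2‖ < 1 := by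
    rw [norm_pow]; exact pow_lt_one₀ (norm_nonneg _) hp1 two_ne_zero
  obtain ⟨C, hC⟩ := exists_norm_gaussBinom_le hq
  have hm : ∀ c : ℂ, Multipliable fun k : ℕ ↦ 1 + c * p ^ (2 * k + 1) := fun c ↦ by
    refine multipliable_one_add_of_summable ?_
    simp only [norm_mul, norm_pow]
    refine Summable.mul_left _ (((summable_geometric_of_lt_one (norm_nonneg p) hp1)).comp_injective
      (i := fun k : ℕ ↦ 2 * k + 1) fun a b h ↦ by simpa using h)
  have lim1 := ((hm s).hasProd.tendsto_prod_nat).mul ((hm s⁻¹).hasProd.tendsto_prod_nat)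
  -- Below -n the term is set to zero by hand, since `toNat` would send all those indices to 0;
  -- above n the Gaussian binomial already vanishes.
  let F : ℕ → ℤ → ℂ := fun n m ↦
    if -(n : ℤ) ≤ m then p ^ (m ^ 2) * s ^ m * gaussBinom (p ^ 2) (2 * n) (m + n).toNat else 0
  have lim2 : Tendsto (fun n ↦ ∑' m, F n m) atTop
      (𝓝 (∑' m : ℤ, p ^ (m ^ 2) * s ^ m * (∏' k : ℕ, (1 - (p ^ 2) ^ (k + 1)))⁻¹)) := by
    refine tendsto_tsum_of_dominated_convergence (bound := fun m ↦ ‖p ^ (m ^ 2) * s ^ m‖ * C)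
      (hsum.mul_right C) (fun m ↦ ?_) (Eventually.of_forall fun n m ↦ ?_)
    · refine ((tendsto_gaussBinom_central hq m).const_mul _).congr' ?_
      filter_upwards [eventually_ge_atTop m.natAbs] with n hn
      simp only [F]
      rw [if_pos (by omega)]
    · simp only [F]
      split_ifs
      · rw [norm_mul]
        exact mul_le_mul_of_nonneg_left (hC _ _) (norm_nonneg _)
      · rw [norm_zero]
        exact mul_nonneg (norm_nonneg _) ((norm_nonneg _).trans (hC 0 0))
  have key : ∀ n : ℕ, ∑' m, F n m = (∏ k ∈ Finset.range n, (1 + s * p ^ (2 * k + 1))) *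
        ∏ k ∈ Finset.range n, (1 + s⁻¹ * p ^ (2 * k + 1)) := fun n ↦ by
    rw [prod_one_add_mul_pow_mul_symm hp hs]
    have hinj : Function.Injective fun j : ℕ ↦ (j : ℤ) - n := fun a b h ↦ by
      simpa using h
    rw [tsum_eq_sum (s := (Finset.range (2 * n + 1)).map ⟨_, hinj⟩), Finset.sum_map]
    · refine Finset.sum_congr rfl fun j _ ↦ ?_
      simp [F]
    · intro m hm
      simp only [F]
      split_ifs with h
      · rw [gaussBinom_eq_zero_of_lt, mul_zero]
        by_contra hcon
        refine hm (Finset.mem_map.mpr ⟨(m + n).toNat, Finset.mem_range.mpr (by omega), ?_⟩)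
        simp only [Function.Embedding.coeFn_mk]
        omega
      · rfl
  have := tendsto_nhds_unique (lim2.congr key) lim1
  rw [tsum_mul_right] at this
  rw [← this, mul_comm, mul_assoc, inv_mul_cancel₀ (tprod_one_sub_pow_ne_zero hq), mul_one]

end RefinedVW

namespace RefinedVW
open Complex Filter Topology

/-! ### The Jacobi form `φ_{-2,1} Δ` -/

/-- The Jacobi theta function `θ₁`, up to a constant. -/
noncomputable def theta₁ (τ z : ℂ) : ℂ :=
  exp (Real.pi * I * τ / 4 + Real.pi * I * z) * jacobiTheta₂ (z + 1 / 2 + τ / 2) τ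

lemma norm_exp_two_pi_I_mul_lt_one {τ : ℂ} (hτ : 0 < τ.im) : ‖exp (2 * Real.pi * I * τ)‖ < 1 :=
  UpperHalfPlane.norm_exp_two_pi_I_lt_one ⟨τ, hτ⟩

/-- The triple product at p = e^{πiτ}, s = -yp. One of its products starts one index early; the
extra factor 1 - y⁻¹ combines with e^{πiz} to give `yDiff z`. -/
lemma theta₁_eq_prod {τ : ℂ} (hτ : 0 < τ.im) (z : ℂ) :
    theta₁ τ z = exp (Real.pi * I * τ / 4) * yDiff z *
      ((∏' k : ℕ, (1 - exp (2 * Real.pi * I * τ) ^ (k + 1))) *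
      ((∏' k : ℕ, (1 - exp (2 * Real.pi * I * τ) ^ (k + 1) * exp (2 * Real.pi * I * z))) *
      ∏' k : ℕ, (1 - exp (2 * Real.pi * I * τ) ^ (k + 1) * exp (-(2 * Real.pi * I * z))))) := by
  obtain ⟨p, hp⟩ : ∃ p, p = exp (Real.pi * I * τ) := ⟨_, rfl⟩
  obtain ⟨y, hy⟩ : ∃ y, y = exp (2 * Real.pi * I * z) := ⟨_, rfl⟩
  have hpp : exp (2 * Real.pi * I * τ) = p ^ 2 := by
    rw [hp, ← exp_nat_mul]; push_cast; ring_nf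
  have hq := norm_exp_two_pi_I_mul_lt_one hτ
  have hp1 : ‖p‖ < 1 := by
    rw [hpp, norm_pow] at hq
    exact (pow_lt_one_iff_of_nonneg (norm_nonneg _) two_ne_zero).mp hq
  have hq2 : ‖p ^ 2‖ < 1 := hpp ▸ hq
  have hyi : exp (-(2 * Real.pi * I * z)) = y⁻¹ := by rw [hy, exp_neg]
  have hy0 : y ≠ 0 := hy ▸ exp_ne_zero _
  have hp0 : p ≠ 0 := hp ▸ exp_ne_zero _
  have hs : exp (2 * Real.pi * I * (z + 1 / 2 + τ / 2)) = -(y * p) := by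
    rw [show 2 * Real.pi * I * (z + 1 / 2 + τ / 2) =
      2 * Real.pi * I * z + Real.pi * I * τ + Real.pi * I by ring, exp_add, exp_add, exp_pi_mul_I, hp, hy]
    ring
  have hterm : ∀ n : ℤ, jacobiTheta₂_term n (z + 1 / 2 + τ / 2) τ =
      p ^ (n ^ 2) * (-(y * p)) ^ n := fun n ↦ by
    rw [jacobiTheta₂_term, ← hs, hp, ← exp_int_mul, ← exp_int_mul, ← exp_add]
    push_cast
    ring_nf
  have hsum : Summable fun n : ℤ ↦ ‖p ^ (n ^ 2) * (-(y * p)) ^ n‖ := by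
    simp only [← hterm]
    exact ((summable_jacobiTheta₂_term_iff _ _).mpr hτ).norm
  have key := jacobi_triple_product hp0 hp1 (neg_ne_zero.mpr (mul_ne_zero hy0 hp0)) hsum
  simp only [← hterm] at key
  have hfac : ∏' k : ℕ, (1 + (-(y * p))⁻¹ * p ^ (2 * k + 1)) =
      (1 - y⁻¹) * ∏' k : ℕ, (1 - (p ^ 2) ^ (k + 1) * y⁻¹) := by
    have e : ∀ k : ℕ, 1 + (-(y * p))⁻¹ * p ^ (2 * k + 1) = 1 - (p ^ 2) ^ k * y⁻¹ := fun k ↦ by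
      field_simp
      ring
    simp only [e]
    have hm : Multipliable fun k : ℕ ↦ 1 - (p ^ 2) ^ (k + 1) * y⁻¹ :=
      multipliable_one_sub_mul_pow hq2 _
    rw [tprod_eq_zero_mul' (f := fun k : ℕ ↦ 1 - (p ^ 2) ^ k * y⁻¹) hm, pow_zero, one_mul]
  have hfac' : ∀ k : ℕ, 1 + -(y * p) * p ^ (2 * k + 1) = 1 - (p ^ 2) ^ (k + 1) * y := fun k ↦ by
    ring
  rw [theta₁, jacobiTheta₂, key, hfac, hyi, hpp, ← hy, yDiff, exp_add]
  simp only [hfac']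
  have h1 : exp (-(Real.pi * I * z)) = exp (Real.pi * I * z) * y⁻¹ := by
    rw [hy, ← exp_neg, ← exp_add]
    ring_nf
  rw [h1]
  ring

lemma eta_pow_six {τ : ℂ} :
    ModularForm.eta τ ^ 6 = exp (Real.pi * I * τ / 4) ^ 2 *
      (∏' k : ℕ, (1 - exp (2 * Real.pi * I * τ) ^ (k + 1))) ^ 6 := by
  simp only [ModularForm.eta, ModularForm.eta_q_eq_pow, mul_pow]
  congr 1
  rw [Function.Periodic.qParam, ← exp_nat_mul, ← exp_nat_mul]
  push_cast
  ring_nf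

lemma phiNegTwoOne_eq_prod {τ : ℂ} (hτ : 0 < τ.im) (z : ℂ) :
    phiNegTwoOne τ z = yDiff z ^ 2 *
      ((∏' k : ℕ, (1 - exp (2 * Real.pi * I * τ) ^ (k + 1) * exp (2 * Real.pi * I * z))) ^ 2 *
      (∏' k : ℕ, (1 - exp (2 * Real.pi * I * τ) ^ (k + 1) * exp (-(2 * Real.pi * I * z)))) ^ 2 /
      (∏' k : ℕ, (1 - exp (2 * Real.pi * I * τ) ^ (k + 1))) ^ 4) := by
  have hq := norm_exp_two_pi_I_mul_lt_one hτ
  have h := fun c ↦ multipliable_one_sub_mul_pow hq c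
  have h1 := ModularForm.multipliable_one_sub_pow hq
  have h0 := tprod_one_sub_pow_ne_zero hq
  rw [phiNegTwoOne]
  congr 1
  refine HasProd.tprod_eq ?_
  exact (((h _).hasProd.pow 2).mul ((h _).hasProd.pow 2)).div₀ (h1.hasProd.pow 4)
    (pow_ne_zero 4 h0)

lemma phiNegTwoOne_mul_eta {τ : ℂ} (hτ : 0 < τ.im) (z : ℂ) :
    phiNegTwoOne τ z * ModularForm.eta τ ^ 6 = theta₁ τ z ^ 2 := by
  have h0 := tprod_one_sub_pow_ne_zero (norm_exp_two_pi_I_mul_lt_one hτ)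
  rw [phiNegTwoOne_eq_prod hτ, eta_pow_six, theta₁_eq_prod hτ]
  generalize ∏' k : ℕ, (1 - exp (2 * Real.pi * I * τ) ^ (k + 1)) = P at h0 ⊢
  generalize ∏' k : ℕ, (1 - exp (2 * Real.pi * I * τ) ^ (k + 1) * exp (2 * Real.pi * I * z)) = Q
  generalize ∏' k : ℕ, (1 - exp (2 * Real.pi * I * τ) ^ (k + 1) * exp (-(2 * Real.pi * I * z))) = R
  field_simp

/-- The weak Jacobi form `φ_{-2,1} Δ` of weight `10` and index `1`. -/
noncomputable def phiDisc (τ z : ℂ) : ℂ := phiNegTwoOne τ z * disc τ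

lemma phiDisc_eq {τ : ℂ} (hτ : 0 < τ.im) (z : ℂ) :
    phiDisc τ z = theta₁ τ z ^ 2 * ModularForm.eta τ ^ 18 := by
  rw [phiDisc, disc, ← phiNegTwoOne_mul_eta hτ]
  ring

lemma exp_two_pi_I_add_one (τ : ℂ) :
    exp (2 * Real.pi * I * (τ + 1)) = exp (2 * Real.pi * I * τ) := by
  rw [mul_add, mul_one, exp_periodic]

lemma phiDisc_add_one (τ z : ℂ) : phiDisc (τ + 1) z = phiDisc τ z := by
  -- In η²⁴ the fractional powers of q disappear, so everything is a function of q alone.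
  have h : ∀ τ, disc τ = exp (2 * Real.pi * I * τ) *
      (∏' k : ℕ, (1 - exp (2 * Real.pi * I * τ) ^ (k + 1))) ^ 24 := fun τ ↦ by
    simp only [disc, ModularForm.eta, ModularForm.eta_q_eq_pow, mul_pow]
    congr 1
    rw [Function.Periodic.qParam, ← exp_nat_mul]
    push_cast
    ring_nf
  simp only [phiDisc, phiNegTwoOne, h, exp_two_pi_I_add_one]

/-- Squaring removes the branch of (-iτ)^{1/2}. The functional equation is applied at z + τ/2 - 1/2,
because this half period, unlike z + τ/2 + 1/2, lands on the right one after division by τ; the two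
differ by a period. -/
lemma theta₁_S {τ : ℂ} (hτ : 0 < τ.im) (z : ℂ) :
    theta₁ (-1 / τ) (z / τ) ^ 2 =
      I * τ * exp (2 * Real.pi * I * z ^ 2 / τ) * theta₁ τ z ^ 2 := by
  have hτ0 : τ ≠ 0 := by rintro rfl; simp at hτ
  have hf := jacobiTheta₂_functional_equation (z + τ / 2 - 1 / 2) τ
  have hper := jacobiTheta₂_add_left (z + τ / 2 - 1 / 2) τ
  rw [show z + τ / 2 - 1 / 2 + 1 = z + 1 / 2 + τ / 2 by ring] at hper
  rw [← hper, show (z + τ / 2 - 1 / 2) / τ = z / τ + 1 / 2 + -1 / τ / 2 by field_simp; ring] at hf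
  have hr : ((-I * τ) ^ (1 / 2 : ℂ)) ^ 2 = -I * τ := by
    rw [one_div]
    exact cpow_nat_inv_pow _ two_ne_zero
  have hr0 : -I * τ ≠ 0 := mul_ne_zero (neg_ne_zero.mpr I_ne_zero) hτ0
  rw [theta₁, theta₁, hf]
  simp only [mul_pow, div_pow, hr, one_pow, ← exp_nat_mul]
  set J := jacobiTheta₂ (z / τ + 1 / 2 + -1 / τ / 2) (-1 / τ) ^ 2
  have he : exp ((2 : ℕ) * (Real.pi * I * (-1 / τ) / 4 + Real.pi * I * (z / τ))) =
      -(exp (2 * Real.pi * I * z ^ 2 / τ) *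
        exp ((2 : ℕ) * (Real.pi * I * τ / 4 + Real.pi * I * z)) *
        exp ((2 : ℕ) * (-Real.pi * I * (z + τ / 2 - 1 / 2) ^ 2 / τ))) := by
    rw [← exp_add, ← exp_add, ← exp_sub_pi_mul_I]
    congr 1
    push_cast
    field_simp
    ring
  rw [he]
  field_simp

/-- θ₁² contributes iτ and η¹⁸ contributes τ⁹/i⁹, so the powers of i cancel. -/
lemma phiDisc_S {τ : ℂ} (hτ : 0 < τ.im) (z : ℂ) :
    phiDisc (-1 / τ) (z / τ) = τ ^ 10 * exp (2 * Real.pi * I * z ^ 2 / τ) * phiDisc τ z := by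
  have hτ0 : τ ≠ 0 := by rintro rfl; simp at hτ
  have hτ' : 0 < (-1 / τ).im := by
    have := UpperHalfPlane.im_inv_neg_coe_pos ⟨τ, hτ⟩
    rwa [neg_div, one_div, ← inv_neg]
  have he : ModularForm.eta (-1 / τ) = (sqrt I)⁻¹ * (sqrt τ * ModularForm.eta τ) := by
    simpa using ModularForm.eta_comp_eq_csqrt_I_inv hτ
  have hsq : ∀ w : ℂ, w ≠ 0 → sqrt w ^ 18 = w ^ 9 := fun w hw ↦ by
    rw [sqrt_eq_exp hw, ← exp_nat_mul, show ((18 : ℕ) : ℂ) * (log w / 2) = (9 : ℕ) * log w by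
      push_cast; ring, exp_nat_mul, exp_log hw]
  rw [phiDisc_eq hτ', phiDisc_eq hτ, theta₁_S hτ, he]
  simp only [mul_pow, inv_pow, hsq τ hτ0, hsq I I_ne_zero]
  rw [show I ^ 9 = I by rw [show 9 = 4 * 2 + 1 by norm_num, pow_succ, pow_mul, I_pow_four]; simp]
  field_simp

/-! ### Modularity under SL(2, ℤ), by induction over words in S and T -/

lemma moebius_denom_ne_zero (γ : Matrix.SpecialLinearGroup (Fin 2) ℤ) {τ : ℂ} (hτ : 0 < τ.im) :
    (γ 1 0 * τ + γ 1 1 : ℂ) ≠ 0 := by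
  have := UpperHalfPlane.denom_ne_zero γ ⟨τ, hτ⟩
  simpa [UpperHalfPlane.denom] using this

lemma im_moebius_pos (γ : Matrix.SpecialLinearGroup (Fin 2) ℤ) {τ : ℂ} (hτ : 0 < τ.im) :
    0 < ((γ 0 0 * τ + γ 0 1) / (γ 1 0 * τ + γ 1 1) : ℂ).im := by
  have := (γ • (⟨τ, hτ⟩ : UpperHalfPlane)).im_pos
  rw [← UpperHalfPlane.coe_im, UpperHalfPlane.coe_specialLinearGroup_apply] at this
  simpa using this

lemma det_cast_eq_one (γ : Matrix.SpecialLinearGroup (Fin 2) ℤ) :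
    (γ 0 0 * γ 1 1 - γ 0 1 * γ 1 0 : ℂ) = 1 := by
  have := γ.det_coe
  rw [Matrix.det_fin_two] at this
  exact_mod_cast this

open Matrix.SpecialLinearGroup in
/-- Modularity of `φ_{-2,1} Δ` under `SL(2, ℤ)`. -/
lemma phiDisc_moebius (γ : Matrix.SpecialLinearGroup (Fin 2) ℤ) {τ : ℂ} (hτ : 0 < τ.im) (z : ℂ) :
    phiDisc ((γ 0 0 * τ + γ 0 1) / (γ 1 0 * τ + γ 1 1)) (z / (γ 1 0 * τ + γ 1 1)) =
      (γ 1 0 * τ + γ 1 1) ^ 10 * exp (2 * Real.pi * I * z ^ 2 * γ 1 0 / (γ 1 0 * τ + γ 1 1)) *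
        phiDisc τ z := by
  have hγ : γ ∈ Subgroup.closure {ModularGroup.S, ModularGroup.T} := by
    simp [SpecialLinearGroup.SL2Z_generators]
  induction hγ using Subgroup.closure_induction generalizing τ z with
  | one => simp
  | mem g hg =>
    rcases hg with rfl | rfl
    · simpa [ModularGroup.S] using phiDisc_S hτ z
    · simpa [ModularGroup.T] using phiDisc_add_one τ z
  | mul g h _ _ ig ih =>
    have j1 := moebius_denom_ne_zero h hτ
    have j2 := moebius_denom_ne_zero g (im_moebius_pos h hτ)
    have j3 := moebius_denom_ne_zero (g * h) hτ
    have hd := det_cast_eq_one h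
    have key := ig (im_moebius_pos h hτ) (z / (h 1 0 * τ + h 1 1))
    rw [ih hτ] at key
    simp only [coe_mul, Matrix.mul_apply, Fin.sum_univ_two, Int.cast_add, Int.cast_mul] at j3 ⊢
    generalize (h 0 0 : ℂ) = a, (h 0 1 : ℂ) = b, (h 1 0 : ℂ) = c, (h 1 1 : ℂ) = d at *
    generalize (g 0 0 : ℂ) = a', (g 0 1 : ℂ) = b', (g 1 0 : ℂ) = c', (g 1 1 : ℂ) = d' at *
    have hj : (c' * ((a * τ + b) / (c * τ + d)) + d') * (c * τ + d) =
        (c' * a + d' * c) * τ + (c' * b + d' * d) := by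
      rw [add_mul, mul_assoc, div_mul_cancel₀ _ j1]
      ring
    have hn : (a' * ((a * τ + b) / (c * τ + d)) + b') * (c * τ + d) =
        (a' * a + b' * c) * τ + (a' * b + b' * d) := by
      rw [add_mul, mul_assoc, div_mul_cancel₀ _ j1]
      ring
    have e1 : (a' * ((a * τ + b) / (c * τ + d)) + b') / (c' * ((a * τ + b) / (c * τ + d)) + d') =
        ((a' * a + b' * c) * τ + (a' * b + b' * d)) /
          ((c' * a + d' * c) * τ + (c' * b + d' * d)) := by
      rw [← hj, ← hn, mul_div_mul_right _ _ j1]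
    have e2 : z / (c * τ + d) / (c' * ((a * τ + b) / (c * τ + d)) + d') =
        z / ((c' * a + d' * c) * τ + (c' * b + d' * d)) := by
      rw [← hj, div_div, mul_comm]
    have e3 : 2 * Real.pi * I * (z / (c * τ + d)) ^ 2 * c' /
          (c' * ((a * τ + b) / (c * τ + d)) + d') +
        2 * Real.pi * I * z ^ 2 * c / (c * τ + d) =
        2 * Real.pi * I * z ^ 2 * (c' * a + d' * c) /
          ((c' * a + d' * c) * τ + (c' * b + d' * d)) := by
      -- The determinant relation ad - bc = 1 turns the lower-left entry of the product into a form
      -- for which the index exponents add up as a cocycle.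
      have hc : (c' * a + d' * c) * (c * τ + d) =
          c' + c * ((c' * ((a * τ + b) / (c * τ + d)) + d') * (c * τ + d)) := by
        rw [hj]
        linear_combination c' * hd
      rw [← hj]
      generalize c' * ((a * τ + b) / (c * τ + d)) + d' = v at *
      generalize c * τ + d = w at *
      rw [← eq_div_iff j1] at hc
      rw [hc]
      field_simp
    rw [e1, e2] at key
    rw [key, ← e3, ← hj, exp_add]
    generalize c' * ((a * τ + b) / (c * τ + d)) + d' = v
    generalize c * τ + d = w
    ring
  | inv g _ ig =>
    have j1 := moebius_denom_ne_zero g⁻¹ hτ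
    have hτ' := im_moebius_pos g⁻¹ hτ
    have j2 := moebius_denom_ne_zero g hτ'
    have hd := det_cast_eq_one g
    have key := ig hτ' (z / (g⁻¹ 1 0 * τ + g⁻¹ 1 1))
    simp only [SL2_inv_expl, Matrix.cons_val', Matrix.cons_val_zero,
      Matrix.cons_val_one, Matrix.cons_val_fin_one, Int.cast_neg] at *
    generalize (g 0 0 : ℂ) = a, (g 0 1 : ℂ) = b, (g 1 0 : ℂ) = c, (g 1 1 : ℂ) = d at *
    have hj : c * ((d * τ + -b) / (-c * τ + a)) + d = 1 / (-c * τ + a) := by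
      rw [eq_div_iff j1, add_mul, mul_assoc, div_mul_cancel₀ _ j1]
      linear_combination hd
    have hn : a * ((d * τ + -b) / (-c * τ + a)) + b = τ / (-c * τ + a) := by
      rw [eq_div_iff j1, add_mul, mul_assoc, div_mul_cancel₀ _ j1]
      linear_combination τ * hd
    rw [hj, hn] at key
    generalize phiDisc ((d * τ + -b) / (-c * τ + a)) (z / (-c * τ + a)) = P at *
    generalize -c * τ + a = w at *
    rw [show τ / w / (1 / w) = τ by field_simp,
      show z / w / (1 / w) = z by field_simp] at key
    rw [key]
    have he : exp (2 * Real.pi * I * z ^ 2 * -c / w) *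
        exp (2 * Real.pi * I * (z / w) ^ 2 * c / (1 / w)) = 1 := by
      rw [← exp_add, exp_eq_one_iff]
      refine ⟨0, ?_⟩
      field_simp
      simp
    have hw : w ^ 10 * (1 / w) ^ 10 = 1 := by field_simp
    linear_combination (-P) * he - exp (2 * Real.pi * I * z ^ 2 * -c / w) *
        exp (2 * Real.pi * I * (z / w) ^ 2 * c / (1 / w)) * P * hw

/-! ### Zeros and holomorphy of Φ -/

lemma yDiff_ne_zero {z : ℂ} (h : ∀ k : ℤ, z ≠ k) : yDiff z ≠ 0 := by
  intro h0
  rw [yDiff, sub_eq_zero, exp_eq_exp_iff_exists_int] at h0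
  obtain ⟨n, hn⟩ := h0
  refine h n ?_
  have : (2 * Real.pi * I) * (z - n) = 0 := by linear_combination hn
  simpa [sub_eq_zero, Real.pi_ne_zero, I_ne_zero] using this

/-- In the product for θ₁ each factor vanishes only at points of ℤ + ℤτ, and an absolutely
convergent product of nonzero factors is nonzero. -/
lemma phiDisc_ne_zero {τ z : ℂ} (hτ : 0 < τ.im) (h : ∀ k l : ℤ, z ≠ k + l * τ) :
    phiDisc τ z ≠ 0 := by
  have hq := norm_exp_two_pi_I_mul_lt_one hτ
  have h1 : ∀ (k : ℕ) (w : ℂ), 1 - exp (2 * Real.pi * I * τ) ^ (k + 1) * exp (2 * Real.pi * I * w)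
      = 0 → ∃ n : ℤ, w = n + (-(k + 1) : ℤ) * τ := fun k w hw ↦ by
    rw [sub_eq_zero, ← exp_nat_mul, ← exp_add, eq_comm, exp_eq_one_iff] at hw
    obtain ⟨n, hn⟩ := hw
    refine ⟨n, ?_⟩
    have : (2 * Real.pi * I) * (w - (n + (-(k + 1) : ℤ) * τ)) = 0 := by
      push_cast at hn ⊢
      linear_combination hn
    simpa only [mul_eq_zero, two_ne_zero, ofReal_eq_zero, Real.pi_ne_zero, I_ne_zero, sub_eq_zero,
      false_or] using this
  rw [phiDisc_eq hτ, theta₁_eq_prod hτ]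
  refine mul_ne_zero (pow_ne_zero _ (mul_ne_zero (mul_ne_zero (exp_ne_zero _) (yDiff_ne_zero ?_))
    (mul_ne_zero (tprod_one_sub_pow_ne_zero hq) (mul_ne_zero
      (tprod_one_sub_mul_pow_ne_zero hq fun k hk ↦ ?_)
      (tprod_one_sub_mul_pow_ne_zero hq fun k hk ↦ ?_)))))
    (pow_ne_zero _ (ModularForm.eta_ne_zero hτ))
  · intro k hk
    exact h k 0 (by simpa using hk)
  · obtain ⟨n, hn⟩ := h1 k z hk
    exact h _ _ hn
  · rw [show -(2 * Real.pi * I * z) = 2 * Real.pi * I * (-z) by ring] at hk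
    obtain ⟨n, hn⟩ := h1 k (-z) hk
    refine h (-n) (k + 1) ?_
    push_cast at hn ⊢
    linear_combination -hn

/-- Through θ₁²η¹⁸ the joint holomorphy of `jacobiTheta₂` suffices, so the infinite products need
not be differentiated. -/
lemma differentiableOn_phiDisc : DifferentiableOn ℂ (fun x : ℂ × ℂ ↦ phiDisc x.1 x.2) dom := by
  have h : ∀ x ∈ dom, phiDisc x.1 x.2 = theta₁ x.1 x.2 ^ 2 * ModularForm.eta x.1 ^ 18 :=
    fun x hx ↦ phiDisc_eq hx _
  refine DifferentiableOn.congr (fun x hx ↦ DifferentiableAt.differentiableWithinAt ?_) h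
  have h1 : DifferentiableAt ℂ (fun x : ℂ × ℂ ↦ ModularForm.eta x.1) x :=
    (ModularForm.differentiableAt_eta_of_mem_upperHalfPlaneSet hx).comp x differentiableAt_fst
  have h2 : DifferentiableAt ℂ
      (fun x : ℂ × ℂ ↦ jacobiTheta₂ (x.2 + 1 / 2 + x.1 / 2) x.1) x := by
    have := (hasFDerivAt_jacobiTheta₂ (x.2 + 1 / 2 + x.1 / 2) hx).differentiableAt
    exact this.comp x (f := fun x : ℂ × ℂ ↦ (x.2 + 1 / 2 + x.1 / 2, x.1)) (by fun_prop)
  unfold theta₁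
  fun_prop
end RefinedVW

namespace RefinedVW
open Complex

/-! ### Gauss sums of quadratic forms over finite fields of odd characteristic -/

section OddGaussSum

variable {F : Type*} [Field F] [Fintype F] [DecidableEq F]

/-- The quadratic character with complex values. -/
noncomputable def quadChar (F : Type*) [Field F] [Fintype F] [DecidableEq F] : MulChar F ℂ :=
  (quadraticChar F).ringHomComp (Int.castRingHom ℂ)

lemma quadChar_apply (a : F) : quadChar F a = (quadraticChar F a : ℂ) := rfl

/-- Group the sum by y = c²: each y has 1 + χ(y) square roots, and the constant 1 sums to zero
against a nontrivial character. -/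
lemma sum_addChar_mul_sq (hF : ringChar F ≠ 2) {ψ : AddChar F ℂ} (hψ : ψ.IsPrimitive) {d : F}
    (hd : d ≠ 0) : ∑ c : F, ψ (d * c ^ 2) = quadChar F d * gaussSum (quadChar F) ψ := by
  have h1 : ∑ c : F, ψ (d * c ^ 2) = ∑ y : F, (quadChar F y + 1) * ψ (d * y) := by
    rw [← Finset.sum_fiberwise Finset.univ (fun c : F ↦ c ^ 2)]
    refine Finset.sum_congr rfl fun y _ ↦ ?_
    rw [Finset.sum_congr rfl (g := fun _ ↦ ψ (d * y)) fun c hc ↦ by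
      rw [(Finset.mem_filter.mp hc).2], Finset.sum_const, nsmul_eq_mul]
    congr 1
    have := quadraticChar_card_sqrts hF y
    rw [Set.toFinset_ofPred] at this
    rw [quadChar_apply]
    exact_mod_cast this
  have h2 : ∑ y : F, ψ (d * y) = 0 := by
    have := AddChar.sum_mulShift d hψ
    simpa [hd, mul_comm] using this
  have h3 := gaussSum_mulShift (quadChar F) ψ (Units.mk0 d hd)
  have h4 : quadChar F d * quadChar F d = 1 := by
    rw [quadChar_apply]
    have := quadraticChar_sq_one hd
    rw [sq] at this
    exact_mod_cast this
  simp only [add_mul, one_mul, Finset.sum_add_distrib, h2, add_zero] at h1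
  rw [h1, ← h3, Units.val_mk0, ← mul_assoc, h4, one_mul]
  rfl

lemma gaussSum_quadChar_sq (hF : ringChar F ≠ 2) {ψ : AddChar F ℂ} (hψ : ψ.IsPrimitive) :
    gaussSum (quadChar F) ψ ^ 2 = quadChar F (-1) * Fintype.card F := by
  refine gaussSum_sq (fun h ↦ ?_) ((quadraticChar_isQuadratic F).comp _) hψ
  obtain ⟨a, ha⟩ := quadraticChar_exists_neg_one hF
  have ha0 : a ≠ 0 := by rintro rfl; simp at ha
  have h1 : quadChar F a = 1 := by
    rw [show quadChar F = 1 from h, MulChar.one_apply ha0.isUnit]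
  rw [quadChar_apply, ha] at h1
  norm_num at h1

open Matrix in
/-- The Gauss sum of a nondegenerate quadratic form. -/
lemma sum_addChar_quadratic (hF : ringChar F ≠ 2) {ψ : AddChar F ℂ} (hψ : ψ.IsPrimitive)
    {ι : Type*} [Fintype ι] [DecidableEq ι] {A : Matrix ι ι F} (hA : Aᵀ = A) (hdet : A.det ≠ 0) :
    ∑ x : ι → F, ψ (x ⬝ᵥ A *ᵥ x) =
      quadChar F A.det * gaussSum (quadChar F) ψ ^ Fintype.card ι := by
  have h2 : (2 : F) ≠ 0 := Ring.two_ne_zero hF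
  let _ : Invertible (2 : F) := invertibleOfNonzero h2
  let B : LinearMap.BilinForm F (ι → F) := Matrix.toBilin' A
  have hB : LinearMap.IsSymm B := by
    refine ⟨fun x y ↦ ?_⟩
    simp only [B, Matrix.toBilin'_apply', RingHom.id_apply]
    rw [dotProduct_comm, ← vecMul_transpose, hA, dotProduct_mulVec]
  -- In an orthogonal basis the sum factors into one-variable Gauss sums.
  obtain ⟨v₀, hv₀⟩ := LinearMap.BilinForm.exists_orthogonal_basis hB
  have hcard : Module.finrank F (ι → F) = Fintype.card ι := Module.finrank_fintype_fun_eq_card F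
  let e : Fin (Module.finrank F (ι → F)) ≃ ι := Fintype.equivOfCardEq (by simp)
  let v := v₀.reindex e
  have hv : ∀ i j, i ≠ j → B (v i) (v j) = 0 := fun i j hij ↦ by
    simp only [v, Module.Basis.reindex_apply]
    exact hv₀ (e.symm.injective.ne hij)
  let d : ι → F := fun i ↦ B (v i) (v i)
  have hD : LinearMap.BilinForm.toMatrix v B = Matrix.diagonal d := by
    ext i j
    rw [LinearMap.BilinForm.toMatrix_apply]
    by_cases hij : i = j
    · subst hij; simp [d]
    · rw [hv i j hij, Matrix.diagonal_apply_ne _ hij]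
  have hAB : LinearMap.BilinForm.toMatrix (Pi.basisFun F ι) B = A := by
    rw [LinearMap.BilinForm.toMatrix_basisFun]
    exact LinearMap.BilinForm.toMatrix'_toBilin' A
  have hdP := LinearMap.BilinForm.toMatrix_mul_basis_toMatrix (Pi.basisFun F ι) v B
  rw [hD, hAB] at hdP
  replace hdP := congrArg Matrix.det hdP
  rw [det_mul, det_mul, det_transpose, det_diagonal] at hdP
  set P := (Pi.basisFun F ι).toMatrix v
  have hP0 : P.det ≠ 0 := by
    have := congrArg Matrix.det ((Pi.basisFun F ι).toMatrix_mul_toMatrix_flip v)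
    rw [det_mul, det_one] at this
    exact left_ne_zero_of_mul_eq_one this
  have hd0 : ∀ i, d i ≠ 0 := by
    have : ∏ i, d i ≠ 0 := by rw [← hdP]; exact mul_ne_zero (mul_ne_zero hP0 hdet) hP0
    exact fun i ↦ (Finset.prod_ne_zero_iff.mp this) i (Finset.mem_univ i)
  -- The base change alters the determinant by the square of det P, which the quadratic character
  -- does not see.
  have hχ : quadChar F A.det = ∏ i, quadChar F (d i) := by
    rw [← map_prod, ← hdP, map_mul, map_mul]
    have := quadraticChar_sq_one hP0
    have h4 : quadChar F P.det * quadChar F P.det = 1 := by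
      rw [quadChar_apply]
      rw [sq] at this
      exact_mod_cast this
    linear_combination (-quadChar F A.det) * h4
  have hq : ∀ c : ι → F, ψ (v.equivFun.symm c ⬝ᵥ A *ᵥ v.equivFun.symm c) =
      ∏ i, ψ (d i * c i ^ 2) := fun c ↦ by
    have : v.equivFun.symm c ⬝ᵥ A *ᵥ v.equivFun.symm c = B (v.equivFun.symm c)
      (v.equivFun.symm c) := (Matrix.toBilin'_apply' A _ _).symm
    have hprod : ∏ i, ψ (d i * c i ^ 2) = ψ (∑ i, d i * c i ^ 2) :=
      (map_prod ψ.toMonoidHom (fun i ↦ Multiplicative.ofAdd (d i * c i ^ 2)) Finset.univ).symm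
    rw [this, Module.Basis.equivFun_symm_apply, hprod]
    congr 1
    simp only [map_sum, LinearMap.sum_apply, map_smul, LinearMap.smul_apply, smul_eq_mul]
    refine Finset.sum_congr rfl fun i _ ↦ ?_
    rw [Finset.sum_eq_single i (fun j _ hj ↦ by rw [hv j i hj]; simp) (by simp)]
    ring
  rw [← Equiv.sum_comp v.equivFun.symm.toEquiv]
  simp only [LinearEquiv.coe_toEquiv, hq]
  rw [← Fintype.prod_sum (fun i c ↦ ψ (d i * c ^ 2))]
  simp only [fun i ↦ sum_addChar_mul_sq hF hψ (hd0 i)]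
  rw [Finset.prod_mul_distrib, hχ, Finset.prod_const, Finset.card_univ]

end OddGaussSum
end RefinedVW

namespace RefinedVW
open Matrix

/-! ### Gauss sums of even quadratic forms at the prime `2` -/

section EvenGaussSum

/-- The function with value `(-1)^k` at `2k`. -/
def evenSign (t : ZMod 8) : ℤ := if t = 0 ∨ t = 4 then 1 else -1

/-- Multiplicativity holds only on even arguments, hence the evenness conditions carried through
this section. -/
lemma evenSign_add (s t : ZMod 8) : evenSign (2 * s + 2 * t) =
    evenSign (2 * s) * evenSign (2 * t) := by
  revert s t
  decide

lemma evenSign_two_mul_intCast (k : ℤ) : evenSign (2 * (k : ZMod 8)) = (-1) ^ k.natAbs := by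
  have h : ∀ t : ZMod 8, evenSign (2 * t) = if t.val % 2 = 0 then 1 else -1 := by decide
  rw [h]
  have h2 := ZMod.val_intCast (n := 8) k
  rcases Nat.even_or_odd k.natAbs with h' | h'
  · rw [h'.neg_one_pow, if_pos]
    have := Int.natAbs_even.mp h'
    push_cast at h2
    grind
  · rw [h'.neg_one_pow, if_neg]
    have := Int.natAbs_odd.mp h'
    push_cast at h2
    grind

lemma sum_evenSign_binary (a b c : ZMod 8) (hb : IsUnit b) :
    ∑ x : ZMod 8, ∑ y : ZMod 8, evenSign (2 * (a * x ^ 2 + b * x * y + c * y ^ 2)) =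
      32 * ZMod.χ₈ (4 * a * c - b ^ 2) := by
  revert a b c
  decide +kernel

/-- Modulo 2 the off-diagonal terms cancel in symmetric pairs, and the diagonal ones vanish. -/
lemma exists_quadratic_eq_two_mul {ι : Type*} [Fintype ι] {A : Matrix ι ι (ZMod 8)} (hA : Aᵀ = A)
    (hd : ∀ i, ∃ a, A i i = 2 * a) (x : ι → ZMod 8) : ∃ t, x ⬝ᵥ A *ᵥ x = 2 * t := by
  have h8 : ∀ s : ZMod 8, ZMod.castHom (by norm_num : 2 ∣ 8) (ZMod 2) s = 0 → ∃ t, s = 2 * t := by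
    decide
  refine h8 _ ?_
  set φ := ZMod.castHom (by norm_num : 2 ∣ 8) (ZMod 2)
  simp only [dotProduct, mulVec, Finset.mul_sum, map_sum, map_mul]
  rw [← Finset.sum_product']
  refine Finset.sum_involution (fun p _ ↦ p.swap) (fun p _ ↦ ?_) (fun p _ hp h ↦ hp ?_)
    (fun _ _ ↦ by simp) (fun _ _ ↦ by simp)
  · have : A p.2 p.1 = A p.1 p.2 := congrFun (congrFun hA p.1) p.2
    simp only [Prod.fst_swap, Prod.snd_swap, this]
    have h2 : (2 : ZMod 2) = 0 := rfl
    linear_combination (φ (x p.1) * (φ (A p.1 p.2) * φ (x p.2))) * h2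
  · obtain ⟨a, ha⟩ := hd p.1
    have h12 : p.2 = p.1 := congrArg Prod.fst h
    have h2 : φ 2 = 0 := rfl
    rw [h12, ha, map_mul, h2]
    simp

variable {ι κ : Type*} [Fintype ι] [DecidableEq ι] [Fintype κ] [DecidableEq κ]

lemma sum_quadratic_submatrix (A : Matrix ι ι (ZMod 8)) (e : κ ≃ ι) :
    ∑ x : κ → ZMod 8, evenSign (x ⬝ᵥ A.submatrix e e *ᵥ x) =
      ∑ x : ι → ZMod 8, evenSign (x ⬝ᵥ A *ᵥ x) := by
  rw [← Equiv.sum_comp (e.arrowCongr (Equiv.refl (ZMod 8)))]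
  refine Finset.sum_congr rfl fun x _ ↦ ?_
  congr 1
  simp only [dotProduct, mulVec, Equiv.arrowCongr_apply, Equiv.coe_refl, Function.comp_def, id]
  rw [← Equiv.sum_comp e]
  refine Finset.sum_congr rfl fun i _ ↦ ?_
  rw [← Equiv.sum_comp e]
  simp

/-- Completing the square: for fixed v the substitution u ↦ u + P⁻¹Cv decouples P from its Schur
complement. -/
lemma sum_quadratic_fromBlocks (P : Matrix κ κ (ZMod 8)) [Invertible P] (hP : Pᵀ = P)
    (hPd : ∀ i, ∃ a, P i i = 2 * a) (C : Matrix κ ι (ZMod 8)) (D : Matrix ι ι (ZMod 8))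
    (hD : (D - Cᵀ * P⁻¹ * C)ᵀ = D - Cᵀ * P⁻¹ * C)
    (hDd : ∀ i, ∃ a, (D - Cᵀ * P⁻¹ * C) i i = 2 * a) :
    ∑ x : κ ⊕ ι → ZMod 8, evenSign (x ⬝ᵥ fromBlocks P C Cᵀ D *ᵥ x) =
      (∑ x : κ → ZMod 8, evenSign (x ⬝ᵥ P *ᵥ x)) *
        ∑ x : ι → ZMod 8, evenSign (x ⬝ᵥ (D - Cᵀ * P⁻¹ * C) *ᵥ x) := by
  let _ : StarRing (ZMod 8) := starRingOfComm
  have key : ∀ (u : κ → ZMod 8) (v : ι → ZMod 8),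
      Sum.elim u v ⬝ᵥ fromBlocks P C Cᵀ D *ᵥ Sum.elim u v =
        (u + (P⁻¹ * C) *ᵥ v) ⬝ᵥ P *ᵥ (u + (P⁻¹ * C) *ᵥ v) +
          v ⬝ᵥ (D - Cᵀ * P⁻¹ * C) *ᵥ v := fun u v ↦ by
    have := schur_complement_eq₁₁ C D u v (A := P) hP
    simp only [dotProduct_mulVec]
    exact this
  rw [← Equiv.sum_comp (Equiv.sumArrowEquivProdArrow κ ι (ZMod 8)).symm, Fintype.sum_prod_type_right,
    Finset.mul_sum]
  refine Finset.sum_congr rfl fun v _ ↦ ?_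
  rw [Finset.sum_mul, ← Equiv.sum_comp (Equiv.addRight ((P⁻¹ * C) *ᵥ v))
    (fun u ↦ evenSign (u ⬝ᵥ P *ᵥ u) * _)]
  refine Finset.sum_congr rfl fun u _ ↦ ?_
  have h1 : (Equiv.sumArrowEquivProdArrow κ ι (ZMod 8)).symm (u, v) = Sum.elim u v := rfl
  rw [h1, key, Equiv.coe_addRight]
  obtain ⟨s, hs⟩ := exists_quadratic_eq_two_mul hP hPd (u + (P⁻¹ * C) *ᵥ v)
  obtain ⟨t, ht⟩ := exists_quadratic_eq_two_mul hD hDd v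
  rw [hs, ht, evenSign_add]

lemma sum_evenSign_matrix_fin_two (a b c : ZMod 8) (hb : IsUnit b) :
    ∑ x : Fin 2 → ZMod 8, evenSign (x ⬝ᵥ !![2 * a, b; b, 2 * c] *ᵥ x) =
      32 * ZMod.χ₈ (4 * a * c - b ^ 2) := by
  rw [← sum_evenSign_binary a b c hb, ← Equiv.sum_comp (finTwoArrowEquiv (ZMod 8)).symm,
    Fintype.sum_prod_type]
  refine Finset.sum_congr rfl fun x _ ↦ Finset.sum_congr rfl fun y _ ↦ ?_
  congr 1
  simp [dotProduct, mulVec, Fin.sum_univ_two]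
  ring

/-- The Gauss sum at `2` of an even unimodular form. -/
theorem exists_sum_evenSign_quadratic (n : ℕ) : ∀ (ι : Type) [Fintype ι] [DecidableEq ι],
    Fintype.card ι = n → ∀ A : Matrix ι ι (ZMod 8), Aᵀ = A → (∀ i, ∃ a, A i i = 2 * a) →
    IsUnit A.det → ∃ k, n = 2 * k ∧
      ∑ x : ι → ZMod 8, evenSign (x ⬝ᵥ A *ᵥ x) = 32 ^ k * ZMod.χ₈ A.det := by
  induction n using Nat.strong_induction_on with
  | _ n ih =>
  intro ι _ _ hn A hA hd hdet
  rcases isEmpty_or_nonempty ι with hι | ⟨⟨i⟩⟩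
  · refine ⟨0, by rw [← hn, Fintype.card_eq_zero], ?_⟩
    simp [evenSign]
  have hunit : ∀ s : ZMod 8, ¬ IsUnit s → ∃ t, s = 2 * t := by decide
  have hev : ∀ t : ZMod 8, ¬ IsUnit (2 * t) := by decide
  -- If no entry of row i were a unit, the row, and hence the determinant, would be divisible by 2.
  obtain ⟨j, hj⟩ : ∃ j, IsUnit (A i j) := by
    by_contra! hcon
    choose f hf using fun j ↦ hunit _ (hcon j)
    have : A = A.updateRow i ((2 : ZMod 8) • f) := by
      ext k l
      by_cases hk : k = i
      · subst hk; simp [hf]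
      · simp [hk]
    rw [this, det_updateRow_smul] at hdet
    exact hev _ hdet
  have hij : i ≠ j := by
    rintro rfl
    obtain ⟨a, ha⟩ := hd i
    exact hev a (ha ▸ hj)
  let κ := {x : ι // ¬ (x = i ∨ x = j)}
  let f : Fin 2 ≃ {x : ι // x = i ∨ x = j} :=
    { toFun := ![⟨i, Or.inl rfl⟩, ⟨j, Or.inr rfl⟩]
      invFun := fun x ↦ if x.1 = i then 0 else 1
      left_inv := by
        intro x
        fin_cases x
        · simp
        · simp [hij.symm]
      right_inv := by
        rintro ⟨x, rfl | rfl⟩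
        · simp
        · simp [hij.symm] }
  let e : Fin 2 ⊕ κ ≃ ι := (Equiv.sumCongr f (Equiv.refl κ)).trans (Equiv.sumCompl _)
  obtain ⟨a, ha⟩ := hd i
  obtain ⟨c, hc⟩ := hd j
  set b := A i j with hb
  have hsymm : ∀ k l, A k l = A l k := fun k l ↦ congrFun (congrFun hA l) k
  let P : Matrix (Fin 2) (Fin 2) (ZMod 8) := !![2 * a, b; b, 2 * c]
  let C : Matrix (Fin 2) κ (ZMod 8) := fun k l ↦ A (e (Sum.inl k)) l
  let D : Matrix κ κ (ZMod 8) := fun k l ↦ A k l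
  have hblock : A.submatrix e e = fromBlocks P C Cᵀ D := by
    ext k l
    rcases k with k | k <;> rcases l with l | l
    · fin_cases k <;> fin_cases l
      · exact ha
      · rfl
      · exact hsymm j i
      · exact hc
    · rfl
    · exact hsymm _ _
    · rfl
  have hPdet : P.det = 4 * a * c - b ^ 2 := by
    rw [det_fin_two_of]; ring
  -- An odd b makes 4ac - b² odd, so the block on i, j is invertible and splits off.
  have hunit' : ∀ a b c : ZMod 8, IsUnit b → ∃ u, u * (4 * a * c - b ^ 2) = 1 := by
    decide +kernel
  obtain ⟨u, hu⟩ := hunit' a b c hj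
  have hPinv : P * (u • !![2 * c, -b; -b, 2 * a]) = 1 := by
    ext k l
    fin_cases k <;> fin_cases l <;> simp [P, Matrix.mul_apply, Fin.sum_univ_two]
    · linear_combination hu
    · ring
    · ring
    · linear_combination hu
  let _ : Invertible P := invertibleOfRightInverse _ _ hPinv
  have hPi : P⁻¹ = u • !![2 * c, -b; -b, 2 * a] := inv_eq_right_inv hPinv
  have hPT : Pᵀ = P := by
    ext k l
    fin_cases k <;> fin_cases l <;> rfl
  have hDT : (D - Cᵀ * P⁻¹ * C)ᵀ = D - Cᵀ * P⁻¹ * C := by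
    have : Dᵀ = D := by ext k l; exact hsymm _ _
    rw [transpose_sub, transpose_mul, transpose_mul, transpose_nonsing_inv, hPT, this,
      transpose_transpose, Matrix.mul_assoc]
  have hPd : ∀ k, ∃ s, P k k = 2 * s := fun k ↦ by
    fin_cases k
    · exact ⟨a, rfl⟩
    · exact ⟨c, rfl⟩
  have hDd : ∀ k, ∃ s, (D - Cᵀ * P⁻¹ * C) k k = 2 * s := fun k ↦ by
    obtain ⟨s, hs⟩ := hd k
    -- Half of the diagonal entry of the Schur complement, read off from the explicit inverse of P:
    -- evenness survives the splitting.
    refine ⟨s - u * (c * C 0 k ^ 2 - b * C 0 k * C 1 k + a * C 1 k ^ 2), ?_⟩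
    rw [hPi, Matrix.sub_apply, Matrix.mul_apply, Fin.sum_univ_two, Matrix.mul_apply,
      Matrix.mul_apply, Fin.sum_univ_two, Fin.sum_univ_two]
    simp only [transpose_apply, Matrix.smul_apply, of_apply, cons_val', cons_val_zero, cons_val_one,
      cons_val_fin_one, smul_eq_mul, show D k k = 2 * s from hs]
    ring
  have hdet' : A.det = P.det * (D - Cᵀ * P⁻¹ * C).det := by
    rw [← det_submatrix_equiv_self e, hblock, det_fromBlocks₁₁, invOf_eq_nonsing_inv]
  have hcard : Fintype.card κ + 2 = n := by
    rw [← hn, ← Fintype.card_congr e, Fintype.card_sum, Fintype.card_fin, add_comm]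
  obtain ⟨k, hk, hsum⟩ := ih (Fintype.card κ) (by omega) κ rfl _ hDT hDd
    (isUnit_of_mul_isUnit_right (hdet' ▸ hdet))
  refine ⟨k + 1, by omega, ?_⟩
  rw [← sum_quadratic_submatrix A e, hblock, sum_quadratic_fromBlocks P hPT hPd C D hDT hDd, hsum,
    sum_evenSign_matrix_fin_two a b c hj, hdet', map_mul, hPdet]
  ring

end EvenGaussSum
end RefinedVW

namespace RefinedVW

/-! ### The discriminant of a K3 lattice -/

section Lattice

lemma prod_neg_of_odd_ncard {ι : Type*} [Fintype ι] {w : ι → ℝ} (h0 : ∀ i, w i ≠ 0)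
    (h : Odd {i | w i < 0}.ncard) : ∏ i, w i < 0 := by
  classical
  have h1 : ∏ i, w i = (∏ i, if w i < 0 then (-1 : ℝ) else 1) * ∏ i, |w i| := by
    rw [← Finset.prod_mul_distrib]
    refine Finset.prod_congr rfl fun i _ ↦ ?_
    split_ifs with hi
    · rw [abs_of_neg hi]; ring
    · rw [abs_of_nonneg (not_lt.mp hi), one_mul]
  rw [h1, Finset.prod_ite, Finset.prod_const, Finset.prod_const_one, mul_one]
  rw [Set.ncard_eq_toFinset_card', Set.toFinset_ofPred] at h
  rw [h.neg_one_pow, neg_one_mul, neg_lt_zero]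
  exact Finset.prod_pos fun i _ ↦ abs_pos.mpr (h0 i)

variable {L : Type*} [AddCommGroup L]

/-- Up to transposition the Gram matrix is the matrix of the isomorphism L → L* in a basis and its
dual. -/
lemma isUnit_det_toMatrix {n : ℕ} (b : Module.Basis (Fin n) ℤ L) (B : LinearMap.BilinForm ℤ L)
    (hB : Function.Bijective fun x : L ↦ B x) :
    IsUnit (LinearMap.BilinForm.toMatrix b B).det := by
  let e : L ≃ₗ[ℤ] Module.Dual ℤ L := LinearEquiv.ofBijective B hB
  have h := LinearEquiv.isUnit_det e b b.dualBasis
  rw [← Matrix.det_transpose] at h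
  refine (congrArg (fun M ↦ IsUnit (Matrix.det M)) ?_).mpr h
  ext i j
  rw [LinearMap.BilinForm.toMatrix_apply, Matrix.transpose_apply, LinearMap.toMatrix_apply]
  simp [e]

-- Unimodularity gives determinant ±1. In a real diagonalisation no weight vanishes, so the rank is
-- 3 + 19, and the 19 negative weights force the sign.
open TensorProduct in
lemma IsK3Lattice.exists_basis [Module.Free ℤ L] [Module.Finite ℤ L] {B : LinearMap.BilinForm ℤ L} (hB : IsK3Lattice B) :
    ∃ b : Module.Basis (Fin 22) ℤ L, (LinearMap.BilinForm.toMatrix b B).det = -1 := by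
  set V := ℝ ⊗[ℤ] L
  set BR : LinearMap.BilinForm ℝ V := B.baseChange ℝ with hBR
  set n := Module.finrank ℝ V with hn
  have hnL : Module.finrank ℤ L = n := (Module.finrank_baseChange).symm
  let b : Module.Basis (Fin n) ℤ L := Module.finBasisOfFinrankEq ℤ L hnL
  let bR : Module.Basis (Fin n) ℝ V := b.baseChange ℝ
  have hsymm : ∀ x y, BR x y = BR y x := fun x y ↦ by
    have h : LinearMap.IsSymm (LinearMap.BilinForm.baseChange ℝ B) :=
      LinearMap.BilinForm.IsSymm.baseChange ℝ ⟨hB.symm⟩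
    exact h.eq x y
  obtain ⟨w, ⟨f⟩⟩ := QuadraticForm.equivalent_weightedSumSquares BR.toQuadraticMap
  have hneg := QuadraticForm.sigNeg_of_equiv_weightedSumSquares ⟨f⟩
  have hpos := QuadraticForm.sigPos_of_equiv_weightedSumSquares ⟨f⟩
  rw [hBR, hB.sigNeg_eq] at hneg
  rw [hBR, hB.sigPos_eq] at hpos
  let v : Module.Basis (Fin n) ℝ V := (Pi.basisFun ℝ (Fin n)).map f.toLinearEquiv.symm
  have hQ : ∀ x : Fin n → ℝ, BR (f.toLinearEquiv.symm x) (f.toLinearEquiv.symm x) =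
      ∑ i, w i * (x i * x i) := fun x ↦ by
    have := f.map_app (f.toLinearEquiv.symm x)
    rw [LinearMap.BilinMap.toQuadraticMap_apply, QuadraticMap.weightedSumSquares_apply] at this
    rw [← this]
    refine Finset.sum_congr rfl fun i _ ↦ ?_
    have : f (f.toLinearEquiv.symm x) = x := f.toLinearEquiv.apply_symm_apply x
    rw [this, smul_eq_mul]
  have hD : LinearMap.BilinForm.toMatrix v BR = Matrix.diagonal w := by
    ext i j
    rw [LinearMap.BilinForm.toMatrix_apply]
    simp only [v, Module.Basis.map_apply, Pi.basisFun_apply]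
    -- Polarisation: the isometry only controls the quadratic form, so the off-diagonal entries come
    -- from its value on a sum.
    have h1 := hQ (Pi.single i 1 + Pi.single j 1)
    have h2 := hQ (Pi.single i 1)
    have h3 := hQ (Pi.single j 1)
    simp only [map_add, LinearMap.add_apply] at h1
    rw [h2, h3, hsymm (f.toLinearEquiv.symm (Pi.single j 1))] at h1
    have h4 : ∑ k, w k * ((Pi.single i 1 + Pi.single j 1 : Fin n → ℝ) k *
        (Pi.single i 1 + Pi.single j 1 : Fin n → ℝ) k) =
        ∑ k, w k * ((Pi.single i 1 : Fin n → ℝ) k * (Pi.single i 1 : Fin n → ℝ) k) +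
        ∑ k, w k * ((Pi.single j 1 : Fin n → ℝ) k * (Pi.single j 1 : Fin n → ℝ) k) +
        2 * ∑ k, w k * ((Pi.single i 1 : Fin n → ℝ) k * (Pi.single j 1 : Fin n → ℝ) k) := by
      rw [Finset.mul_sum, ← Finset.sum_add_distrib, ← Finset.sum_add_distrib]
      refine Finset.sum_congr rfl fun k _ ↦ ?_
      rw [Pi.add_apply]
      ring
    have h5 : ∑ k, w k * ((Pi.single i 1 : Fin n → ℝ) k * (Pi.single j 1 : Fin n → ℝ) k) =
        Matrix.diagonal w i j := by
      rw [Finset.sum_eq_single i (fun k _ hk ↦ by rw [Pi.single_eq_of_ne hk]; ring) (by simp)]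
      by_cases hij : i = j
      · subst hij; simp
      · rw [Pi.single_eq_of_ne hij, Matrix.diagonal_apply_ne _ hij]; ring
    linarith
  have hA : LinearMap.BilinForm.toMatrix bR BR =
      (LinearMap.BilinForm.toMatrix b B).map (Int.castRingHom ℝ) := by
    ext i j
    rw [LinearMap.BilinForm.toMatrix_apply, Matrix.map_apply, LinearMap.BilinForm.toMatrix_apply]
    rw [Module.Basis.baseChange_apply, Module.Basis.baseChange_apply, hBR,
      LinearMap.BilinForm.baseChange_tmul]
    simp
  have hdet := congrArg Matrix.det (LinearMap.BilinForm.toMatrix_mul_basis_toMatrix bR v BR)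
  rw [hD, hA, Matrix.det_mul, Matrix.det_mul, Matrix.det_transpose, Matrix.det_diagonal,
    ← RingHom.mapMatrix_apply, ← RingHom.map_det] at hdet
  have hP0 : (bR.toMatrix v).det ≠ 0 := by
    have := congrArg Matrix.det (bR.toMatrix_mul_toMatrix_flip v)
    rw [Matrix.det_mul, Matrix.det_one] at this
    exact left_ne_zero_of_mul_eq_one this
  have hu := Int.isUnit_iff.mp (isUnit_det_toMatrix b B hB.unimodular)
  have hw0 : ∀ i, w i ≠ 0 := by
    have : ∏ i, w i ≠ 0 := by
      rw [← hdet]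
      refine mul_ne_zero (mul_ne_zero hP0 ?_) hP0
      rcases hu with h | h <;> simp [h]
    exact fun i ↦ Finset.prod_ne_zero_iff.mp this i (Finset.mem_univ i)
  have hprod : ∏ i, w i < 0 := prod_neg_of_odd_ncard hw0 (by rw [← hneg]; decide)
  have hdet1 : (LinearMap.BilinForm.toMatrix b B).det = -1 := by
    refine hu.resolve_left fun h ↦ hprod.not_ge ?_
    rw [← hdet, h]
    simpa using mul_self_nonneg _
  have h22 : n = 22 := by
    have h1 : ({i | 0 < w i} ∪ {i | w i < 0}).ncard = 3 + 19 := by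
      rw [Set.ncard_union_eq, ← hneg, ← hpos]
      exact Set.disjoint_left.mpr fun i (h1 : 0 < w i) (h2 : w i < 0) ↦ h1.not_gt h2
    have h2 : ({i | 0 < w i} ∪ {i | w i < 0}) = Set.univ :=
      Set.eq_univ_of_forall fun i ↦ (hw0 i).lt_or_gt.symm
    rw [h2, Set.ncard_univ, Nat.card_fin] at h1
    exact h1
  refine ⟨b.reindex (finCongr h22), ?_⟩
  rw [← hdet1, ← Matrix.det_submatrix_equiv_self (finCongr h22)]
  congr 1
  ext i j
  simp [LinearMap.BilinForm.toMatrix_apply]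

end Lattice
end RefinedVW

namespace RefinedVW
open Complex

/-! ### Gauss sums over `L / rL` -/

section LatticeSums

variable {L : Type*} [AddCommGroup L]

lemma mem_multiples_iff {r : ℕ} {x : L} : x ∈ multiples L r ↔ ∃ y : L, (r : ℤ) • y = x := Iff.rfl

lemma smul_mem_multiples (r : ℕ) (y : L) : (r : ℤ) • y ∈ multiples L r := ⟨y, rfl⟩

lemma exists_out_mk_eq (r : ℕ) (x : L) :
    ∃ y : L, (Submodule.Quotient.mk x : L ⧸ multiples L r).out = x + (r : ℤ) • y := by
  have h : (Submodule.Quotient.mk (Submodule.Quotient.mk x : L ⧸ multiples L r).out :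
    L ⧸ multiples L r) = Submodule.Quotient.mk x := Quotient.out_eq _
  obtain ⟨y, hy⟩ := mem_multiples_iff.mp ((Submodule.Quotient.eq _).mp h)
  exact ⟨y, by rw [hy]; abel⟩

/-- An r-periodic function descends to L/rL, where translation by d is a bijection. -/
lemma finsum_out_add {r : ℕ} {g : L → ℂ} (hg : ∀ x y, g (x + (r : ℤ) • y) = g x) (d : L) :
    ∑ᶠ a : L ⧸ multiples L r, g (a.out + d) = ∑ᶠ a : L ⧸ multiples L r, g a.out := by
  refine Eq.trans (finsum_congr fun a ↦ ?_)
    (finsum_comp_equiv (Equiv.addRight (Submodule.Quotient.mk d : L ⧸ multiples L r)))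
  have ha : a + Submodule.Quotient.mk d = Submodule.Quotient.mk (a.out + d) := by
    rw [Submodule.Quotient.mk_add]
    congr 1
    exact (Quotient.out_eq a).symm
  obtain ⟨y, hy⟩ := exists_out_mk_eq r (a.out + d)
  change _ = g (a + Submodule.Quotient.mk d : L ⧸ multiples L r).out
  rw [ha, hy, hg]

lemma bijective_mk_sum {r n : ℕ} [NeZero r] (b : Module.Basis (Fin n) ℤ L) :
    Function.Bijective fun u : Fin n → ZMod r ↦
      (Submodule.Quotient.mk (∑ i, ((u i).val : ℤ) • b i) : L ⧸ multiples L r) := by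
  constructor
  · intro u v huv
    obtain ⟨y, hy⟩ := mem_multiples_iff.mp ((Submodule.Quotient.eq _).mp huv)
    funext i
    have := congrArg (fun x ↦ b.repr x i) hy
    simp only [map_sub, map_sum, map_smul, Module.Basis.repr_self, Finsupp.coe_sub, Pi.sub_apply,
      Finsupp.coe_finsetSum, Finset.sum_apply, Finsupp.smul_single, Finsupp.single_apply,
      Finset.sum_ite_eq', Finset.mem_univ, if_true, smul_eq_mul, mul_one,
      Finsupp.smul_apply] at this
    have h2 := congrArg (Int.cast : ℤ → ZMod r) this
    push_cast at h2
    simpa [sub_eq_zero, eq_comm] using h2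
  · intro a
    refine ⟨fun i ↦ (b.repr a.out i : ZMod r), ?_⟩
    refine Eq.trans ?_ (Quotient.out_eq a)
    refine (Submodule.Quotient.eq _).mpr (mem_multiples_iff.mpr
      ⟨∑ i, (-(b.repr a.out i / r)) • b i, ?_⟩)
    conv_rhs => rw [← b.sum_repr a.out]
    rw [Finset.smul_sum, ← Finset.sum_sub_distrib]
    refine Finset.sum_congr rfl fun i _ ↦ ?_
    rw [smul_smul, ← sub_smul, b.sum_repr]
    congr 1
    rw [ZMod.val_intCast]
    have := Int.emod_add_mul_ediv (b.repr a.out i) r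
    linarith

lemma finite_quotient_multiples [Module.Free ℤ L] [Module.Finite ℤ L] (r : ℕ) [NeZero r] :
    Finite (L ⧸ multiples L r) :=
  Finite.of_surjective _ (bijective_mk_sum (r := r) (Module.finBasis ℤ L)).surjective

lemma finsum_out_eq_sum {r n : ℕ} [NeZero r] (b : Module.Basis (Fin n) ℤ L) {g : L → ℂ}
    (hg : ∀ x y, g (x + (r : ℤ) • y) = g x) :
    ∑ᶠ a : L ⧸ multiples L r, g a.out =
      ∑ u : Fin n → ZMod r, g (∑ i, ((u i).val : ℤ) • b i) := by
  rw [← finsum_eq_sum_of_fintype]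
  refine (finsum_eq_of_bijective _ (bijective_mk_sum b) fun u ↦ ?_).symm
  obtain ⟨y, hy⟩ := exists_out_mk_eq r (∑ i, ((u i).val : ℤ) • b i)
  rw [hy, hg]

/-- Half of the quadratic form of an even lattice. -/
def halfForm (B : LinearMap.BilinForm ℤ L) (x : L) : ℤ := B x x / 2

variable {B : LinearMap.BilinForm ℤ L}

lemma two_mul_halfForm (he : ∀ x : L, Even (B x x)) (x : L) : 2 * halfForm B x = B x x :=
  Int.mul_ediv_cancel' (even_iff_two_dvd.mp (he x))

lemma halfForm_add (he : ∀ x : L, Even (B x x)) (hs : ∀ x y : L, B x y = B y x) (x y : L) :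
    halfForm B (x + y) = halfForm B x + halfForm B y + B x y := by
  have h1 := two_mul_halfForm he (x + y)
  have h2 := two_mul_halfForm he x
  have h3 := two_mul_halfForm he y
  simp only [map_add, LinearMap.add_apply, hs y x] at h1
  linarith

lemma halfForm_smul (he : ∀ x : L, Even (B x x)) (k : ℤ) (x : L) :
    halfForm B (k • x) = k ^ 2 * halfForm B x := by
  have h1 := two_mul_halfForm he (k • x)
  have h2 := two_mul_halfForm he x
  simp only [map_smul, LinearMap.smul_apply, smul_eq_mul] at h1
  refine mul_left_cancel₀ two_ne_zero ?_
  linear_combination h1 - k ^ 2 * h2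

/-- Q(x + ry) = Q(x) + rB(x,y) + r²Q(y); evenness keeps this integral, which matters at r = 2. -/
lemma halfForm_add_smul_cast (he : ∀ x : L, Even (B x x)) (hs : ∀ x y : L, B x y = B y x) (r : ℕ)
    (x y : L) : (halfForm B (x + (r : ℤ) • y) : ZMod r) = halfForm B x := by
  rw [halfForm_add he hs, halfForm_smul he, map_smul]
  simp

lemma bilin_add_smul_cast (r : ℕ) (c x y : L) :
    (B c (x + (r : ℤ) • y) : ZMod r) = B c x := by
  rw [map_add, map_smul]
  simp

/-- The functional B(c,·)/r is integral, so by unimodularity it is B(y,·) for some y, and then c =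
ry. -/
lemma mem_multiples_of_bilin_cast_eq_zero (hu : Function.Bijective fun x : L ↦ B x) {r : ℕ}
    (hr : r ≠ 0) {c : L} (h : ∀ d, (B c d : ZMod r) = 0) : c ∈ multiples L r := by
  have hdvd : ∀ d, (r : ℤ) ∣ B c d := fun d ↦ (ZMod.intCast_zmod_eq_zero_iff_dvd _ _).mp (h d)
  have hr' : (r : ℤ) ≠ 0 := by exact_mod_cast hr
  let f : Module.Dual ℤ L :=
    { toFun := fun d ↦ B c d / r
      map_add' := fun x y ↦ by rw [map_add, Int.add_ediv_of_dvd_left (hdvd x)]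
      map_smul' := fun k x ↦ by
        rw [map_smul, smul_eq_mul, Int.mul_ediv_assoc _ (hdvd x)]; rfl }
  obtain ⟨y, hy⟩ := hu.2 f
  refine mem_multiples_iff.mpr ⟨y, hu.1 (LinearMap.ext fun d ↦ ?_)⟩
  have h1 : B y d = B c d / r := congrArg (fun φ : Module.Dual ℤ L ↦ φ d) hy
  change B ((r : ℤ) • y) d = B c d
  rw [map_smul, LinearMap.smul_apply, h1, smul_eq_mul, Int.mul_ediv_cancel' (hdvd d)]

open Classical in
/-- Orthogonality of characters on `L / rL`. -/
lemma finsum_stdAddChar_bilin (hu : Function.Bijective fun x : L ↦ B x)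
    {r n : ℕ} [NeZero r] (b : Module.Basis (Fin n) ℤ L) (c : L) :
    ∑ᶠ a : L ⧸ multiples L r, (ZMod.stdAddChar (B c a.out : ZMod r) : ℂ) =
      if c ∈ multiples L r then (r : ℂ) ^ n else 0 := by
  have hper : ∀ x y, (ZMod.stdAddChar (B c (x + (r : ℤ) • y) : ZMod r) : ℂ) =
      ZMod.stdAddChar (B c x : ZMod r) := fun x y ↦ by rw [bilin_add_smul_cast]
  split_ifs with hc
  · obtain ⟨y, rfl⟩ := mem_multiples_iff.mp hc
    rw [finsum_out_eq_sum b (g := fun x ↦ ZMod.stdAddChar (B ((r : ℤ) • y) x : ZMod r)) hper]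
    simp
  · obtain ⟨d, hd⟩ : ∃ d, (B c d : ZMod r) ≠ 0 := by
      by_contra! hcon
      exact hc (mem_multiples_of_bilin_cast_eq_zero hu (NeZero.ne r) hcon)
    -- Translation by d multiplies the sum by a value of the character other than 1, so the sum
    -- vanishes.
    have h := finsum_out_add (g := fun x ↦ ZMod.stdAddChar (B c x : ZMod r)) hper d
    simp only [map_add, Int.cast_add, AddChar.map_add_eq_mul] at h
    rw [← finsum_mul] at h
    by_contra h0
    have h1 : ZMod.stdAddChar (B c d : ZMod r) = (1 : ℂ) :=
      mul_left_cancel₀ h0 (h.trans (mul_one _).symm)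
    refine hd (ZMod.injective_stdAddChar ?_)
    rw [h1, AddChar.map_zero_eq_one]

/-- The Gauss sum of a K3 lattice modulo an odd prime. -/
lemma finsum_stdAddChar_halfForm_of_odd (he : ∀ x : L, Even (B x x))
    (hs : ∀ x y : L, B x y = B y x) {r : ℕ} [Fact r.Prime] (hr2 : r ≠ 2)
    (b : Module.Basis (Fin 22) ℤ L) (hb : (LinearMap.BilinForm.toMatrix b B).det = -1)
    {t : ZMod r} (ht : t ≠ 0) :
    ∑ᶠ a : L ⧸ multiples L r, (ZMod.stdAddChar (t * halfForm B a.out : ZMod r) : ℂ) =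
      (r : ℂ) ^ 11 := by
  have hchar : ringChar (ZMod r) ≠ 2 := by rwa [ZMod.ringChar_zmod_n]
  have h2 : (2 : ZMod r) ≠ 0 := Ring.two_ne_zero hchar
  set A : Matrix (Fin 22) (Fin 22) (ZMod r) :=
    (LinearMap.BilinForm.toMatrix b B).map (Int.castRingHom (ZMod r)) with hAdef
  have hA : A.transpose = A := by
    ext i j
    simp [A, LinearMap.BilinForm.toMatrix_apply, hs (b j)]
  have hdet : A.det = -1 := by
    rw [hAdef, ← RingHom.mapMatrix_apply, ← RingHom.map_det, hb]
    simp
  -- The factor 1/2 passes from Q(x) to B(x,x).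
  set ψ : AddChar (ZMod r) ℂ := ZMod.stdAddChar.mulShift (t / 2)
  have hψ : ψ.IsPrimitive := fun a ha ↦ by
    rw [AddChar.mulShift_mulShift]
    exact ZMod.isPrimitive_stdAddChar r (mul_ne_zero (div_ne_zero ht h2) ha)
  rw [finsum_out_eq_sum b (g := fun x ↦ ZMod.stdAddChar (t * halfForm B x : ZMod r))
    (fun x y ↦ by rw [halfForm_add_smul_cast he hs])]
  have hterm : ∀ u : Fin 22 → ZMod r,
      ZMod.stdAddChar (t * halfForm B (∑ i, ((u i).val : ℤ) • b i) : ZMod r) =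
        ψ (u ⬝ᵥ A.mulVec u) := fun u ↦ by
    rw [AddChar.mulShift_apply]
    congr 1
    have h3 := congrArg (Int.cast : ℤ → ZMod r)
      (two_mul_halfForm he (∑ i, ((u i).val : ℤ) • b i))
    have h4 : (B (∑ i, ((u i).val : ℤ) • b i) (∑ i, ((u i).val : ℤ) • b i) : ZMod r) =
        u ⬝ᵥ A.mulVec u := by
      simp only [map_sum, LinearMap.sum_apply, map_smul, LinearMap.smul_apply, smul_eq_mul,
        Int.cast_sum, Int.cast_mul, dotProduct, Matrix.mulVec, Finset.mul_sum]
      rw [Finset.sum_comm]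
      refine Finset.sum_congr rfl fun i _ ↦ Finset.sum_congr rfl fun j _ ↦ ?_
      simp [A, LinearMap.BilinForm.toMatrix_apply]
      ring
    rw [h4] at h3
    push_cast at h3
    rw [← h3]
    field_simp
  simp only [hterm]
  -- The value is χ(-1)(χ(-1)r)¹¹ = χ(-1)¹² r¹¹, so the quadratic character drops out.
  rw [sum_addChar_quadratic hchar hψ hA (by rw [hdet]; exact neg_ne_zero.mpr one_ne_zero),
    Fintype.card_fin, hdet, show 22 = 2 * 11 by norm_num, pow_mul,
    gaussSum_quadChar_sq hchar hψ, mul_pow, ZMod.card, ← mul_assoc, ← pow_succ',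
    show 11 + 1 = 2 * 6 by norm_num, pow_mul, quadChar_apply]
  have := quadraticChar_sq_one (F := ZMod r) (neg_ne_zero.mpr one_ne_zero)
  rw [show ((quadraticChar (ZMod r) (-1) : ℤ) : ℂ) ^ 2 = 1 by exact_mod_cast this]
  simp

lemma stdAddChar_two_eq_evenSign (k : ℤ) :
    (ZMod.stdAddChar (k : ZMod 2) : ℂ) = (evenSign (2 * (k : ZMod 8)) : ℂ) := by
  rw [evenSign_two_mul_intCast, ZMod.stdAddChar_coe]
  rw [show 2 * Real.pi * I * k / (2 : ℕ) = k * (Real.pi * I) by push_cast; ring, exp_int_mul,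
    exp_pi_mul_I]
  push_cast
  rcases Int.even_or_odd k with h | h
  · rw [h.neg_one_zpow, (Int.natAbs_even.mpr h).neg_one_pow]
  · rw [h.neg_one_zpow, (Int.natAbs_odd.mpr h).neg_one_pow]

/-- The Gauss sum of a K3 lattice modulo `2`. -/
lemma finsum_stdAddChar_halfForm_two (he : ∀ x : L, Even (B x x))
    (hs : ∀ x y : L, B x y = B y x)
    (b : Module.Basis (Fin 22) ℤ L) (hb : (LinearMap.BilinForm.toMatrix b B).det = -1) :
    ∑ᶠ a : L ⧸ multiples L 2, (ZMod.stdAddChar (halfForm B a.out : ZMod 2) : ℂ) =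
      (2 : ℂ) ^ 11 := by
  set A : Matrix (Fin 22) (Fin 22) (ZMod 8) :=
    (LinearMap.BilinForm.toMatrix b B).map (Int.castRingHom (ZMod 8)) with hAdef
  have hA : A.transpose = A := by
    ext i j
    simp [A, LinearMap.BilinForm.toMatrix_apply, hs (b j)]
  have hdet : A.det = -1 := by
    rw [hAdef, ← RingHom.mapMatrix_apply, ← RingHom.map_det, hb]
    simp
  have hd : ∀ i, ∃ a, A i i = 2 * a := fun i ↦ ⟨halfForm B (b i), by
    have := congrArg (Int.cast : ℤ → ZMod 8) (two_mul_halfForm he (b i))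
    push_cast at this
    rw [this]
    simp [A, LinearMap.BilinForm.toMatrix_apply]⟩
  obtain ⟨k, hk, hsum⟩ := exists_sum_evenSign_quadratic 22 (Fin 22) (Fintype.card_fin 22) A hA hd
    (by rw [hdet]; exact isUnit_one.neg)
  obtain rfl : k = 11 := by omega
  have hper : ∀ x y, (ZMod.stdAddChar (halfForm B (x + ((2 : ℕ) : ℤ) • y) : ZMod 2) : ℂ) =
      ZMod.stdAddChar (halfForm B x : ZMod 2) := fun x y ↦ by
    rw [halfForm_add_smul_cast he hs]
  rw [finsum_out_eq_sum b (g := fun x ↦ ZMod.stdAddChar (halfForm B x : ZMod 2)) hper]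
  have hquad : ∀ w : Fin 22 → ℤ, (2 * (halfForm B (∑ i, w i • b i) : ZMod 8)) =
      (fun i ↦ (w i : ZMod 8)) ⬝ᵥ A.mulVec (fun i ↦ (w i : ZMod 8)) := fun w ↦ by
    have h3 := congrArg (Int.cast : ℤ → ZMod 8) (two_mul_halfForm he (∑ i, w i • b i))
    push_cast at h3
    rw [h3]
    simp only [map_sum, LinearMap.sum_apply, map_smul, LinearMap.smul_apply, smul_eq_mul,
      Int.cast_sum, Int.cast_mul, dotProduct, Matrix.mulVec, Finset.mul_sum]
    rw [Finset.sum_comm]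
    refine Finset.sum_congr rfl fun i _ ↦ Finset.sum_congr rfl fun j _ ↦ ?_
    simp [A, LinearMap.BilinForm.toMatrix_apply]
    ring
  -- Write residues mod 8 as u + 2w. The summand depends only on u mod 2, so the sum mod 8, which is
  -- 32¹¹, is 4²² times the sum over L/2L.
  let e : ZMod 2 × ZMod 4 ≃ ZMod 8 :=
    Equiv.ofBijective (fun p ↦ ((p.1.val + 2 * p.2.val : ℕ) : ZMod 8)) (by decide)
  let E : (Fin 22 → ZMod 2) × (Fin 22 → ZMod 4) ≃ (Fin 22 → ZMod 8) :=
    (Equiv.arrowProdEquivProdArrow (Fin 22) (fun _ ↦ ZMod 2) (fun _ ↦ ZMod 4)).symm.trans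
      ((Equiv.refl (Fin 22)).arrowCongr e)
  have hE : ∀ u w, (evenSign (E (u, w) ⬝ᵥ A.mulVec (E (u, w))) : ℂ) =
      ZMod.stdAddChar (halfForm B (∑ i, ((u i).val : ℤ) • b i) : ZMod 2) := fun u w ↦ by
    have h1 : E (u, w) = fun i ↦ (((u i).val + 2 * (w i).val : ℤ) : ZMod 8) := by
      funext i
      simp [E, e, Equiv.arrowProdEquivProdArrow]
    rw [h1, ← hquad, ← stdAddChar_two_eq_evenSign, ← hper (∑ i, ((u i).val : ℤ) • b i)
      (∑ i, ((w i).val : ℤ) • b i), Finset.smul_sum, ← Finset.sum_add_distrib]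
    simp only [add_smul, mul_smul, Nat.cast_ofNat]
  have htot := congrArg (Int.cast : ℤ → ℂ) hsum
  rw [Int.cast_sum, ← Equiv.sum_comp E, Fintype.sum_prod_type] at htot
  simp only [hE, Finset.sum_const, Finset.card_univ, Fintype.card_fun, ZMod.card,
    Fintype.card_fin, nsmul_eq_mul] at htot
  rw [← Finset.mul_sum, hdet, show ZMod.χ₈ (-1) = 1 by decide] at htot
  have h4 : ((4 ^ 22 : ℕ) : ℂ) ≠ 0 := by norm_num
  refine mul_left_cancel₀ h4 (htot.trans ?_)
  norm_num

lemma finsum_stdAddChar_halfForm [Module.Free ℤ L] [Module.Finite ℤ L] (hB : IsK3Lattice B)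
    {r : ℕ} [hr : Fact r.Prime] {t : ZMod r} (ht : t ≠ 0) :
    ∑ᶠ a : L ⧸ multiples L r, (ZMod.stdAddChar (t * halfForm B a.out : ZMod r) : ℂ) =
      (r : ℂ) ^ 11 := by
  obtain ⟨b, hb⟩ := hB.exists_basis
  by_cases hr2 : r = 2
  · subst hr2
    have h1 : t = 1 := Fin.eq_one_of_ne_zero t ht
    simp only [h1, one_mul]
    exact finsum_stdAddChar_halfForm_two hB.even hB.symm b hb
  · exact finsum_stdAddChar_halfForm_of_odd hB.even hB.symm hr2 b hb ht

/-- Completing the square in the Gauss sum of a K3 lattice. -/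
lemma finsum_stdAddChar_bilin_mul_halfForm [Module.Free ℤ L] [Module.Finite ℤ L]
    (hB : IsK3Lattice B) {r : ℕ} [hr : Fact r.Prime] {t m : ZMod r} (htm : m * t = -1) (c : L) :
    ∑ᶠ a : L ⧸ multiples L r, (ZMod.stdAddChar (B c a.out : ZMod r) : ℂ) *
        ZMod.stdAddChar (-(t * halfForm B a.out) : ZMod r) =
      (r : ℂ) ^ 11 * ZMod.stdAddChar (-(m * halfForm B c) : ZMod r) := by
  have ht : t ≠ 0 := by
    rintro rfl
    rw [mul_zero] at htm
    exact one_ne_zero (neg_eq_zero.mp htm.symm)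
  obtain ⟨M, rfl⟩ : ∃ M : ℤ, m = M := ⟨m.val, by simp⟩
  let g : L → ℂ := fun x ↦ ZMod.stdAddChar (-t * halfForm B x : ZMod r)
  have hg : ∀ x y, g (x + (r : ℤ) • y) = g x := fun x y ↦ by
    simp only [g]
    rw [halfForm_add_smul_cast hB.even hB.symm]
  -- As mt = -1, one has B(c,x) - tQ(x) = -tQ(x + mc) - mQ(c) modulo r; the shift by mc is then
  -- absorbed into the sum.
  have h1 : ∀ x : L, (ZMod.stdAddChar (B c x : ZMod r) : ℂ) *
      ZMod.stdAddChar (-(t * halfForm B x) : ZMod r) =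
      g (x + M • c) * ZMod.stdAddChar (-(M * halfForm B c) : ZMod r) := fun x ↦ by
    simp only [g]
    rw [← AddChar.map_add_eq_mul, ← AddChar.map_add_eq_mul, halfForm_add hB.even hB.symm,
      halfForm_smul hB.even, map_smul, smul_eq_mul, hB.symm x c]
    congr 1
    push_cast
    linear_combination (M * halfForm B c + B c x : ZMod r) * htm
  simp only [h1]
  rw [← finsum_mul, finsum_out_add hg, finsum_stdAddChar_halfForm hB (neg_ne_zero.mpr ht)]

end LatticeSums
end RefinedVW

namespace RefinedVW
open Complex

/-! ### The transformations of the K3 formulas -/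

section Transformations

lemma phiDisc_add_intCast (τ z : ℂ) (n : ℤ) : phiDisc (τ + n) z = phiDisc τ z := by
  induction n using Int.induction_on with
  | zero => simp
  | succ n ih =>
    rw [← ih, ← phiDisc_add_one (τ + (n : ℤ))]
    push_cast
    ring_nf
  | pred n ih =>
    rw [← ih, ← phiDisc_add_one (τ + (-n - 1 : ℤ))]
    push_cast
    ring_nf

lemma phiDisc_div_eq {r : ℕ} [NeZero r] (τ z : ℂ) (k : ℤ) :
    phiDisc ((τ + ((k : ZMod r).val : ℂ)) / r) z = phiDisc ((τ + k) / r) z := by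
  have hr : (r : ℂ) ≠ 0 := NeZero.ne _
  have h := ZMod.val_intCast (n := r) k
  have h2 := congrArg (Int.cast : ℤ → ℂ) (Int.emod_add_mul_ediv k r)
  rw [← h] at h2
  push_cast at h2
  rw [← phiDisc_add_intCast _ z (k / r), ← h2]
  congr 1
  field_simp
  ring

lemma sum_range_eq_sum_zmod {r : ℕ} [NeZero r] (f : ℕ → ℂ) :
    ∑ m ∈ Finset.range r, f m = ∑ m : ZMod r, f m.val :=
  Finset.sum_nbij' (fun m ↦ (m : ZMod r)) ZMod.val (by simp)
    (fun m _ ↦ Finset.mem_range.mpr m.val_lt)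
    (fun m hm ↦ ZMod.val_cast_of_lt (Finset.mem_range.mp hm)) (fun m _ ↦ by simp)
    (fun m hm ↦ by rw [ZMod.val_cast_of_lt (Finset.mem_range.mp hm)])

variable {L : Type*} [AddCommGroup L] {B : LinearMap.BilinForm ℤ L}

/-- Since r - 1 ≡ -1 mod r and c² = 2Q(c), the phase is a character value depending only on m mod r.
-/
lemma exp_eq_stdAddChar_halfForm (he : ∀ x : L, Even (B x x)) {r : ℕ} [NeZero r] (m : ℤ) (c : L) :
    exp (I * Real.pi * (r - 1) / r * m * B c c) =
      ZMod.stdAddChar (-(m * halfForm B c) : ZMod r) := by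
  have h : (-(m * halfForm B c) : ZMod r) = (((r - 1) * m * halfForm B c : ℤ) : ZMod r) := by
    push_cast
    rw [CharP.cast_eq_zero]
    ring
  rw [h, ZMod.stdAddChar_coe, ← two_mul_halfForm he c]
  push_cast
  ring_nf

lemma exp_eq_stdAddChar_bilin {r : ℕ} [NeZero r] (c a : L) :
    exp (2 * Real.pi * I / r * B c a) = ZMod.stdAddChar (B c a : ZMod r) := by
  rw [ZMod.stdAddChar_coe]
  ring_nf

open Classical in
/-- The quotient of `k3Total` by `(y^{1/2} - y^{-1/2})²`. -/
noncomputable def k3Reduced (r : ℕ) [NeZero r] (B : LinearMap.BilinForm ℤ L) (c : L) (τ z : ℂ) : ℂ :=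
  1 / r * ∑ m : ZMod r, ZMod.stdAddChar (-(m * halfForm B c) : ZMod r) *
    (phiDisc ((τ + m.val) / r) z)⁻¹ +
  (phiDisc (r * τ) (r * z))⁻¹ * (if c ∈ multiples L r then 1 else 0)

lemma k3Total_eq (he : ∀ x : L, Even (B x x)) (r : ℕ) [NeZero r] (c : L) (τ z : ℂ) :
    k3Total r B c τ z = yDiff z ^ 2 * k3Reduced r B c τ z := by
  rw [k3Total, k3Inst, k3Mono, k3Reduced, sum_range_eq_sum_zmod (fun m ↦
    exp (I * Real.pi * (r - 1) / r * m * B c c) *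
    (yDiff z ^ 2 / (phiNegTwoOne ((τ + m) / r) z * disc ((τ + m) / r)))), mul_add,
    Finset.mul_sum, Finset.mul_sum, Finset.mul_sum]
  congr 1
  · refine Finset.sum_congr rfl fun m _ ↦ ?_
    have := exp_eq_stdAddChar_halfForm he (r := r) m.val c
    have hv : ((m.val : ℤ) : ZMod r) = m := by simp
    rw [hv, Int.cast_natCast] at this
    rw [this, ← phiDisc]
    ring
  · rw [← phiDisc]
    ring

lemma halfForm_cast_eq_zero (he : ∀ x : L, Even (B x x)) {r : ℕ} {c : L}
    (hc : c ∈ multiples L r) : (halfForm B c : ZMod r) = 0 := by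
  obtain ⟨y, rfl⟩ := mem_multiples_iff.mp hc
  rw [halfForm_smul he]
  simp

open Classical in
lemma k3Reduced_congr (he : ∀ x : L, Even (B x x)) (hs : ∀ x y : L, B x y = B y x) {r : ℕ}
    [NeZero r] {c c' : L} (h : c - c' ∈ multiples L r) :
    k3Reduced r B c = k3Reduced r B c' := by
  obtain ⟨y, hy⟩ := mem_multiples_iff.mp h
  obtain rfl : c = c' + (r : ℤ) • y := by rw [hy]; abel
  funext τ z
  rw [k3Reduced, k3Reduced, halfForm_add_smul_cast he hs]
  congr 2
  exact if_congr ((multiples L r).add_mem_iff_left (smul_mem_multiples r y)) rfl rfl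

/-- T reindexes m ↦ m + 1, which costs the phase. The monopole term is invariant, and the phase is
trivial when it is present. -/
lemma k3Reduced_add_one (he : ∀ x : L, Even (B x x)) (r : ℕ) [NeZero r] (c : L) (τ z : ℂ) :
    k3Reduced r B c (τ + 1) z =
      exp (-(I * Real.pi * (r - 1) / r * B c c)) * k3Reduced r B c τ z := by
  have hexp : exp (-(I * Real.pi * (r - 1) / r * B c c)) =
      ZMod.stdAddChar (halfForm B c : ZMod r) := by
    have := exp_eq_stdAddChar_halfForm he (r := r) (-1) c
    push_cast at this
    rw [neg_one_mul, neg_neg] at this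
    rw [← this]
    ring_nf
  rw [hexp, k3Reduced, k3Reduced, mul_add (ZMod.stdAddChar _)]
  congr 1
  · rw [mul_left_comm]
    congr 1
    rw [Finset.mul_sum]
    refine Fintype.sum_equiv (Equiv.addRight (1 : ZMod r)) _ _ fun m ↦ ?_
    rw [Equiv.coe_addRight, ← mul_assoc, ← AddChar.map_add_eq_mul]
    congr 2
    · ring_nf
    · have := phiDisc_div_eq (r := r) τ z (m.val + 1)
      rw [Int.cast_add, Int.cast_natCast, Int.cast_one, ZMod.natCast_zmod_val] at this
      rw [this]
      push_cast
      ring_nf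
  · split_ifs with hc
    · have h := phiDisc_add_intCast (r * τ) (r * z) r
      rw [Int.cast_natCast, ← mul_add_one] at h
      rw [halfForm_cast_eq_zero he hc, AddChar.map_zero_eq_one, one_mul, h]
    · simp

/-- The Hecke-type translate of `φ_{-2,1} Δ` at a nonzero residue class under `S`. -/
lemma phiDisc_S_of_mul_eq_neg_one {r : ℕ} [NeZero r] {m t : ZMod r} (hmt : m * t = -1) {τ : ℂ}
    (hτ : 0 < τ.im) (z : ℂ) :
    phiDisc ((-1 / τ + m.val) / r) (z / τ) =
      τ ^ 10 * exp (2 * Real.pi * I * z ^ 2 / τ * r) * phiDisc ((τ + t.val) / r) z := by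
  have hτ0 : τ ≠ 0 := by rintro rfl; simp at hτ
  have hr : (r : ℂ) ≠ 0 := NeZero.ne _
  obtain ⟨x, hx⟩ : (r : ℤ) ∣ m.val * t.val + 1 := by
    rw [← ZMod.intCast_zmod_eq_zero_iff_dvd]
    push_cast
    rw [ZMod.natCast_val, ZMod.natCast_val, ZMod.cast_id, ZMod.cast_id, hmt, neg_add_cancel]
  -- With mt + 1 = rx this matrix sends (τ+t)/r to (-1/τ+m)/r, and its automorphy factor there is
  -- exactly τ.
  let γ : Matrix.SpecialLinearGroup (Fin 2) ℤ := ⟨!![(m.val : ℤ), -x; r, -t.val], by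
    rw [Matrix.det_fin_two_of]; linear_combination -hx⟩
  have hτ' : 0 < ((τ + t.val) / r).im := by
    rw [div_natCast_im, add_im, natCast_im, add_zero]
    exact div_pos hτ (by exact_mod_cast Nat.pos_of_ne_zero (NeZero.ne r))
  have h := phiDisc_moebius γ hτ' z
  have h00 : (γ 0 0 : ℂ) = m.val := by simp [γ]
  have h01 : (γ 0 1 : ℂ) = -x := by simp [γ]
  have h10 : (γ 1 0 : ℂ) = r := by simp [γ]
  have h11 : (γ 1 1 : ℂ) = -t.val := by simp [γ]
  rw [h00, h01, h10, h11] at h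
  have hx' : (m.val * t.val + 1 : ℂ) = r * x := by exact_mod_cast hx
  have hden : (r : ℂ) * ((τ + t.val) / r) + -t.val = τ := by field_simp; ring
  have hnum : ((m.val : ℂ) * ((τ + t.val) / r) + -x) / τ = (-1 / τ + m.val) / r := by
    field_simp
    linear_combination hx'
  rw [hden, hnum] at h
  rw [h]
  ring_nf

/-- S applied at (rτ, rz): the m = 0 instanton translate turns into the monopole function.
`phiDisc_S_mono` is the reverse passage, S applied at (τ/r, z). -/
lemma phiDisc_S_zero {r : ℕ} [NeZero r] {τ : ℂ} (hτ : 0 < τ.im) (z : ℂ) :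
    phiDisc ((-1 / τ) / r) (z / τ) =
      r ^ 10 * τ ^ 10 * exp (2 * Real.pi * I * z ^ 2 / τ * r) * phiDisc (r * τ) (r * z) := by
  have hτ0 : τ ≠ 0 := by rintro rfl; simp at hτ
  have hr : (r : ℂ) ≠ 0 := NeZero.ne _
  have hr' : (0 : ℝ) < r := by exact_mod_cast Nat.pos_of_ne_zero (NeZero.ne r)
  have hτ' : 0 < (r * τ).im := by simpa using mul_pos hr' hτ
  have h := phiDisc_S hτ' (r * z)
  rw [show -1 / (r * τ) = (-1 / τ) / r by field_simp,
    show (r * z) / (r * τ) = z / τ by field_simp] at h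
  rw [h, mul_pow, show 2 * Real.pi * I * (r * z) ^ 2 / (r * τ) =
    2 * Real.pi * I * z ^ 2 / τ * r by field_simp]

lemma phiDisc_S_mono {r : ℕ} [NeZero r] {τ : ℂ} (hτ : 0 < τ.im) (z : ℂ) :
    r ^ 10 * phiDisc (r * (-1 / τ)) (r * (z / τ)) =
      τ ^ 10 * exp (2 * Real.pi * I * z ^ 2 / τ * r) * phiDisc (τ / r) z := by
  have hτ0 : τ ≠ 0 := by rintro rfl; simp at hτ
  have hr : (r : ℂ) ≠ 0 := NeZero.ne _
  have hr' : (0 : ℝ) < r := by exact_mod_cast Nat.pos_of_ne_zero (NeZero.ne r)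
  have hτ' : 0 < (τ / r).im := by rw [div_natCast_im]; exact div_pos hτ hr'
  have h := phiDisc_S hτ' z
  rw [show -1 / (τ / r) = r * (-1 / τ) by field_simp,
    show z / (τ / r) = r * (z / τ) by field_simp] at h
  rw [h, show 2 * Real.pi * I * z ^ 2 / (τ / r) = 2 * Real.pi * I * z ^ 2 / τ * r by field_simp]
  field_simp

open Classical in
lemma finsum_stdAddChar_bilin_mul_delta (r : ℕ) [NeZero r] (c : L) :
    ∑ᶠ a : L ⧸ multiples L r, (ZMod.stdAddChar (B c a.out : ZMod r) : ℂ) *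
      (if a.out ∈ multiples L r then 1 else 0) = 1 := by
  have h0 : ∀ a : L ⧸ multiples L r, a.out ∈ multiples L r ↔ a = 0 := fun a ↦ by
    conv_rhs => rw [← Quotient.out_eq a]
    exact (Submodule.Quotient.mk_eq_zero _).symm
  rw [finsum_eq_single _ 0 fun a ha ↦ by rw [if_neg ((h0 a).not.mpr ha), mul_zero]]
  rw [if_pos ((h0 0).mpr rfl), mul_one]
  obtain ⟨y, hy⟩ := mem_multiples_iff.mp ((h0 0).mpr rfl)
  rw [← hy, map_smul]
  simp

/-- Term-by-term comparison of the permuted translates with the Fourier transforms of their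
coefficients. With 0⁻¹ = 0 it holds even at the poles. -/
lemma k3Reduced_S [Module.Free ℤ L] [Module.Finite ℤ L] (hB : IsK3Lattice B) (r : ℕ)
    [hr : Fact r.Prime] (c : L) {τ : ℂ} (hτ : 0 < τ.im) (z : ℂ) :
    k3Reduced r B c (-1 / τ) (z / τ) =
      (r : ℂ) ^ (-11 : ℤ) * τ ^ (-10 : ℤ) * exp (-(2 * Real.pi * I * z ^ 2 / τ * r)) *
        ∑ᶠ a : L ⧸ multiples L r, exp (2 * Real.pi * I / r * B c a.out) *
          k3Reduced r B a.out τ z := by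
  classical
  have hτ0 : τ ≠ 0 := by rintro rfl; simp at hτ
  have hr0 : (r : ℂ) ≠ 0 := NeZero.ne _
  obtain ⟨b, -⟩ := hB.exists_basis
  have := finite_quotient_multiples (L := L) r
  have := Fintype.ofFinite (L ⧸ multiples L r)
  have hsum : ∑ᶠ a : L ⧸ multiples L r, exp (2 * Real.pi * I / r * B c a.out) *
          k3Reduced r B a.out τ z =
      1 / r * ∑ t : ZMod r, (∑ᶠ a : L ⧸ multiples L r,
        (ZMod.stdAddChar (B c a.out : ZMod r) : ℂ) *
          ZMod.stdAddChar (-(t * halfForm B a.out) : ZMod r)) *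
        (phiDisc ((τ + t.val) / r) z)⁻¹ + (phiDisc (r * τ) (r * z))⁻¹ := by
    have hmono : (phiDisc (r * τ) (r * z))⁻¹ = (phiDisc (r * τ) (r * z))⁻¹ *
        ∑ᶠ a : L ⧸ multiples L r, (ZMod.stdAddChar (B c a.out : ZMod r) : ℂ) *
          (if a.out ∈ multiples L r then 1 else 0) := by
      rw [finsum_stdAddChar_bilin_mul_delta, mul_one]
    rw [hmono]
    simp only [finsum_eq_sum_of_fintype, exp_eq_stdAddChar_bilin, k3Reduced, mul_add,
      Finset.sum_add_distrib, Finset.mul_sum, Finset.sum_mul]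
    congr 1
    · rw [Finset.sum_comm]
      refine Finset.sum_congr rfl fun t _ ↦ Finset.sum_congr rfl fun a _ ↦ by ring
    · exact Finset.sum_congr rfl fun a _ ↦ by ring
  have hzero : ∑ᶠ a : L ⧸ multiples L r, (ZMod.stdAddChar (B c a.out : ZMod r) : ℂ) *
      ZMod.stdAddChar (-(0 * halfForm B a.out) : ZMod r) =
        if c ∈ multiples L r then (r : ℂ) ^ 22 else 0 := by
    simp only [zero_mul, neg_zero, AddChar.map_zero_eq_one, mul_one]
    exact finsum_stdAddChar_bilin hB.unimodular b c
  -- The permutation of the translates induced by S; the convention 0⁻¹ = 0 fixes 0, which is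
  -- treated separately.
  let e : ZMod r ≃ ZMod r :=
    Function.Involutive.toPerm (fun m ↦ -m⁻¹) fun m ↦ by simp
  rw [hsum, k3Reduced, ← Equiv.sum_comp e,
    Fintype.sum_eq_add_sum_compl 0, Fintype.sum_eq_add_sum_compl 0, hzero]
  have hne : ∀ t ∈ ({0}ᶜ : Finset (ZMod r)),
      ZMod.stdAddChar (-(e t * halfForm B c) : ZMod r) *
        (phiDisc ((-1 / τ + (e t).val) / r) (z / τ))⁻¹ =
      (r : ℂ) ^ (-11 : ℤ) * τ ^ (-10 : ℤ) * exp (-(2 * Real.pi * I * z ^ 2 / τ * r)) *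
      ((∑ᶠ a : L ⧸ multiples L r, (ZMod.stdAddChar (B c a.out : ZMod r) : ℂ) *
          ZMod.stdAddChar (-(t * halfForm B a.out) : ZMod r)) *
        (phiDisc ((τ + t.val) / r) z)⁻¹) := fun t ht ↦ by
    have ht0 : t ≠ 0 := by simpa using ht
    have hmt : e t * t = -1 := by
      change -t⁻¹ * t = -1
      rw [neg_mul, inv_mul_cancel₀ ht0]
    rw [finsum_stdAddChar_bilin_mul_halfForm hB hmt, phiDisc_S_of_mul_eq_neg_one hmt hτ, mul_inv,
      mul_inv, ← exp_neg]
    generalize (phiDisc ((τ + t.val) / r) z)⁻¹ = G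
    rw [zpow_neg, zpow_neg]
    norm_cast
    field_simp
  rw [Finset.sum_congr rfl hne, ← Finset.mul_sum]
  generalize ∑ t ∈ ({0}ᶜ : Finset (ZMod r)), (∑ᶠ a : L ⧸ multiples L r,
    (ZMod.stdAddChar (B c a.out : ZMod r) : ℂ) *
      ZMod.stdAddChar (-(t * halfForm B a.out) : ZMod r)) * (phiDisc ((τ + t.val) / r) z)⁻¹ = X
  have he0 : e 0 = 0 := by
    change -(0 : ZMod r)⁻¹ = 0
    simp
  have h1 := phiDisc_S_zero (r := r) hτ z
  have h2 : (phiDisc (r * (-1 / τ)) (r * (z / τ)))⁻¹ = r ^ 10 * (τ ^ 10)⁻¹ *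
      exp (-(2 * Real.pi * I * z ^ 2 / τ * r)) * (phiDisc (τ / r) z)⁻¹ := by
    have := congrArg (·⁻¹) (phiDisc_S_mono (r := r) hτ z)
    simp only [mul_inv] at this
    rw [exp_neg]
    field_simp at this ⊢
    linear_combination this
  rw [he0, ZMod.val_zero, Nat.cast_zero, add_zero, add_zero, h1, h2, zero_mul, neg_zero,
    AddChar.map_zero_eq_one, mul_inv, mul_inv, mul_inv, ← exp_neg,
    show (r : ℂ) ^ (-11 : ℤ) = ((r : ℂ) ^ 11)⁻¹ by rw [zpow_neg]; norm_cast,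
    show τ ^ (-10 : ℤ) = (τ ^ 10)⁻¹ by rw [zpow_neg]; norm_cast]
  generalize (phiDisc (τ / r) z)⁻¹ = G
  generalize (phiDisc (r * τ) (r * z))⁻¹ = G'
  split_ifs
  · field_simp
    ring
  · field_simp
    ring

end Transformations
end RefinedVW

namespace RefinedVW
open Complex

/-! ### Meromorphy and equality of meromorphic functions -/

section Meromorphy

lemma isOpen_dom : IsOpen dom := isOpen_lt continuous_const (by fun_prop)

/-- Density can be tested on each slice of fixed τ, where a countable exceptional set has dense
complement. -/
lemma dom_subset_closure {P : ℂ × ℂ → Prop}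
    (h : ∀ τ : ℂ, 0 < τ.im → {z : ℂ | ¬P (τ, z)}.Countable) : dom ⊆ closure {x ∈ dom | P x} := by
  rintro ⟨τ, z⟩ hτ
  refine map_mem_closure (f := fun w : ℂ ↦ (τ, w)) (by fun_prop)
    ((h τ hτ).dense_compl ℂ z) fun w hw ↦ ⟨hτ, not_not.mp hw⟩

lemma countable_mul_mem_lattice (r : ℕ) [NeZero r] (τ : ℂ) :
    {z : ℂ | ¬∀ k l : ℤ, (r : ℂ) * z ≠ k + l * τ}.Countable := by
  refine (Set.countable_range fun p : ℤ × ℤ ↦ ((p.1 + p.2 * τ) / r : ℂ)).mono fun z hz ↦ ?_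
  simp only [Set.mem_ofPred_eq, not_forall, not_not] at hz
  obtain ⟨k, l, h⟩ := hz
  exact ⟨(k, l), by simp only [← h, mul_div_cancel_left₀ _ (NeZero.ne (r : ℂ))]⟩

variable {r : ℕ} {τ z : ℂ}

lemma phiDisc_div_ne_zero [NeZero r] (hτ : 0 < τ.im) (hz : ∀ k l : ℤ, (r : ℂ) * z ≠ k + l * τ) (m : ℕ) :
    phiDisc ((τ + m) / r) z ≠ 0 := by
  have hr : (r : ℂ) ≠ 0 := NeZero.ne _
  refine phiDisc_ne_zero ?_ fun k l h ↦ hz (r * k + l * m) l ?_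
  · rw [div_natCast_im, add_im, natCast_im, add_zero]
    exact div_pos hτ (by exact_mod_cast Nat.pos_of_ne_zero (NeZero.ne r))
  · rw [h]
    push_cast
    field_simp
    ring

lemma phiDisc_mul_ne_zero [NeZero r] (hτ : 0 < τ.im) (hz : ∀ k l : ℤ, (r : ℂ) * z ≠ k + l * τ) :
    phiDisc (r * τ) (r * z) ≠ 0 := by
  have hr' : (0 : ℝ) < r := by exact_mod_cast Nat.pos_of_ne_zero (NeZero.ne r)
  refine phiDisc_ne_zero (by simpa using mul_pos hr' hτ) fun k l h ↦ hz k (l * r) ?_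
  rw [h]
  push_cast
  ring

lemma yDiff_ne_zero_of_mul (hz : ∀ k l : ℤ, (r : ℂ) * z ≠ k + l * τ) : yDiff z ≠ 0 :=
  yDiff_ne_zero fun k h ↦ hz (r * k) 0 (by rw [h]; push_cast; ring)

lemma yDiff_div_ne_zero_of_mul (hτ : 0 < τ.im) (hz : ∀ k l : ℤ, (r : ℂ) * z ≠ k + l * τ) :
    yDiff (z / τ) ≠ 0 := by
  have hτ0 : τ ≠ 0 := by rintro rfl; simp at hτ
  refine yDiff_ne_zero fun k h ↦ hz 0 (r * k) ?_
  rw [div_eq_iff hτ0] at h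
  rw [h]
  push_cast
  ring

lemma differentiable_yDiff : Differentiable ℂ yDiff := by
  unfold yDiff
  fun_prop

variable {L : Type*} [AddCommGroup L] {B : LinearMap.BilinForm ℤ L}

/-- The product of all r + 1 translates of Φ is a global common denominator, nonzero off rz ∈ ℤ +
ℤτ. -/
lemma isMeromorphic_k3Total (he : ∀ x : L, Even (B x x)) (r : ℕ) [NeZero r] (c : L) :
    IsMeromorphic (k3Total r B c) := by
  classical
  intro p hp
  have hr' : (0 : ℝ) < r := by exact_mod_cast Nat.pos_of_ne_zero (NeZero.ne r)
  let f : ZMod r → ℂ × ℂ → ℂ := fun m x ↦ phiDisc ((x.1 + m.val) / r) x.2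
  let f' : ℂ × ℂ → ℂ := fun x ↦ phiDisc (r * x.1) (r * x.2)
  have hf : ∀ m, DifferentiableOn ℂ (f m) dom := fun m ↦
    differentiableOn_phiDisc.comp (f := fun x : ℂ × ℂ ↦ ((x.1 + m.val) / r, x.2)) (by fun_prop)
      fun x (hx : 0 < x.1.im) ↦ by
        change 0 < ((x.1 + m.val) / r).im
        rw [div_natCast_im, add_im, natCast_im, add_zero]
        exact div_pos hx hr'
  have hf' : DifferentiableOn ℂ f' dom :=
    differentiableOn_phiDisc.comp (f := fun x : ℂ × ℂ ↦ (r * x.1, r * x.2)) (by fun_prop)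
      fun x (hx : 0 < x.1.im) ↦ by
        change 0 < (r * x.1).im
        simpa using mul_pos hr' hx
  have hprod : ∀ s : Finset (ZMod r), DifferentiableOn ℂ (fun x ↦ ∏ k ∈ s, f k x) dom := by
    intro s
    induction s using Finset.induction_on with
    | empty => simp
    | insert a s ha ih =>
      simp only [Finset.prod_insert ha]
      exact (hf a).mul ih
  refine ⟨dom, isOpen_dom, hp, subset_rfl,
    fun x ↦ yDiff x.2 ^ 2 * (1 / r * (∑ m, ZMod.stdAddChar (-(m * halfForm B c) : ZMod r) *
      ∏ k ∈ Finset.univ.erase m, f k x) * f' x +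
        (∏ k, f k x) * (if c ∈ multiples L r then 1 else 0)),
    fun x ↦ (∏ k, f k x) * f' x, ?_, ?_, ?_, fun x hx hne ↦ ?_⟩
  · refine (((differentiable_yDiff.comp differentiable_snd).differentiableOn).pow 2).mul
      (((DifferentiableOn.fun_sum fun m _ ↦ (hprod _).const_mul _).const_mul _ |>.mul hf').add
        ((hprod _).mul_const _))
  · exact (hprod _).mul hf'
  · refine dom_subset_closure fun τ hτ ↦ (countable_mul_mem_lattice r τ).mono ?_
    refine fun z hz hz' ↦ hz ?_
    exact mul_ne_zero (Finset.prod_ne_zero_iff.mpr fun m _ ↦ phiDisc_div_ne_zero hτ hz' m.val)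
      (phiDisc_mul_ne_zero hτ hz')
  · obtain ⟨hne₁, hne₂⟩ := mul_ne_zero_iff.mp hne
    have hm : ∀ m, ∏ k ∈ Finset.univ.erase m, f k x = (∏ k, f k x) * (f m x)⁻¹ := fun m ↦ by
      rw [← Finset.mul_prod_erase _ _ (Finset.mem_univ m), mul_comm, inv_mul_cancel_left₀]
      exact Finset.prod_ne_zero_iff.mp hne₁ m (Finset.mem_univ m)
    have hs : ∑ m, ZMod.stdAddChar (-(m * halfForm B c) : ZMod r) *
        ∏ k ∈ Finset.univ.erase m, f k x = (∏ k, f k x) *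
          ∑ m, ZMod.stdAddChar (-(m * halfForm B c) : ZMod r) * (f m x)⁻¹ := by
      rw [Finset.mul_sum]
      exact Finset.sum_congr rfl fun m _ ↦ by rw [hm]; ring
    rw [k3Total_eq he, k3Reduced, eq_div_iff hne]
    simp only [hs]
    change _ * (_ * (∑ m, _ * (f m x)⁻¹) + (f' x)⁻¹ * _) * _ = _
    field_simp

lemma tFactor_two_zero (r : ℕ) (c : ℤ) :
    tFactor r 2 0 c = exp (-(I * Real.pi * (r - 1) / r * c)) := by
  rw [tFactor, mul_comm (r : ℤ), zpow_mul]
  norm_num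
  ring_nf

lemma sFactor_two_zero (r : ℕ) (τ z : ℂ) :
    sFactor r 2 0 24 τ z =
      (r : ℂ) ^ (-11 : ℤ) * τ ^ (-10 : ℤ) * exp (-(2 * Real.pi * I * z ^ 2 / τ * r)) := by
  rw [sFactor, mul_comm (r : ℤ), zpow_mul,
    show (1 - ((24 : ℤ) : ℂ) / 2) = ((-11 : ℤ) : ℂ) by norm_num,
    show (-5 * ((2 : ℤ) : ℂ) + ((0 : ℤ) : ℂ) / 2) = ((-10 : ℤ) : ℂ) by norm_num,
    cpow_intCast, cpow_intCast]
  norm_num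

lemma k3Total_add_one (he : ∀ x : L, Even (B x x)) (r : ℕ) [NeZero r] (c : L) (τ z : ℂ) :
    k3Total r B c (τ + 1) z =
      exp (-(I * Real.pi * (r - 1) / r * B c c)) * k3Total r B c τ z := by
  rw [k3Total_eq he, k3Total_eq he, k3Reduced_add_one he]
  ring

lemma k3Total_S [Module.Free ℤ L] [Module.Finite ℤ L] (hB : IsK3Lattice B) (r : ℕ)
    [Fact r.Prime] (c : L) {τ z : ℂ} (hτ : 0 < τ.im) (hz : yDiff z ≠ 0)
    (hz' : yDiff (z / τ) ≠ 0) :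
    k3Total r B c (-1 / τ) (z / τ) / yDiff (z / τ) ^ 2 =
      (r : ℂ) ^ (-11 : ℤ) * τ ^ (-10 : ℤ) * exp (-(2 * Real.pi * I * z ^ 2 / τ * r)) *
        ∑ᶠ a : L ⧸ multiples L r, exp (2 * Real.pi * I / r * B c a.out) *
          (k3Total r B a.out τ z / yDiff z ^ 2) := by
  simp only [k3Total_eq hB.even, mul_div_cancel_left₀ _ (pow_ne_zero 2 hz)]
  rw [mul_div_cancel_left₀ _ (pow_ne_zero 2 hz'), k3Reduced_S hB r c hτ z]

lemma refinedModular_k3Total [Module.Free ℤ L] [Module.Finite ℤ L] (hB : IsK3Lattice B) (r : ℕ)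
    [Fact r.Prime] : RefinedModular r 2 0 24 B (k3Total r B) where
  meromorphic := isMeromorphic_k3Total hB.even r
  trans_T c := ⟨dom, isOpen_dom, subset_rfl, subset_closure, fun x _ ↦ by
    simp only [tFactor_two_zero, k3Total_add_one hB.even]⟩
  trans_S c := by
    refine ⟨{x ∈ dom | yDiff x.2 ≠ 0 ∧ yDiff (x.2 / x.1) ≠ 0}, ?_, Set.sep_subset _ _, ?_, ?_⟩
    · refine ContinuousOn.isOpen_inter_preimage
        (f := fun x : ℂ × ℂ ↦ (yDiff x.2, yDiff (x.2 / x.1)))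
        (t := {y : ℂ × ℂ | y.1 ≠ 0 ∧ y.2 ≠ 0}) ?_ isOpen_dom ?_
      · have h := differentiable_yDiff.continuous
        refine ContinuousOn.prodMk (by fun_prop) (h.comp_continuousOn ?_)
        refine continuousOn_snd.div continuousOn_fst fun x (hx : 0 < x.1.im) h0 ↦ ?_
        simp [h0] at hx
      · exact (isOpen_ne_fun continuous_fst continuous_const).inter
          (isOpen_ne_fun continuous_snd continuous_const)
    · refine dom_subset_closure fun τ hτ ↦ (countable_mul_mem_lattice r τ).mono ?_
      exact fun z hz hz' ↦
        hz ⟨yDiff_ne_zero_of_mul hz', yDiff_div_ne_zero_of_mul hτ hz'⟩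
    · rintro ⟨τ, z⟩ ⟨hτ, hz, hz'⟩
      have h := k3Total_S hB r c hτ hz hz'
      simp only [sFactor_two_zero]
      exact_mod_cast h

end Meromorphy
end RefinedVW

namespace RefinedVW
open Complex

/-! ### Fourier expansions -/

section Fourier

open Filter Topology

lemma IsFourierExpansion.add {N : ℕ} {Z Z' : QYSeries} {F F' : ℂ → ℂ → ℂ}
    (h : IsFourierExpansion N Z F) (h' : IsFourierExpansion N Z' F') :
    IsFourierExpansion N (Z + Z') fun τ z ↦ F τ z + F' τ z := by
  filter_upwards [h, h'] with z ⟨hd, M, hM, hs⟩ ⟨hd', M', _, hs'⟩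
  refine ⟨fun n h0 ↦ ?_, max M M', hM.trans (le_max_left _ _), fun τ hτ ↦ ?_⟩
  · have := Polynomial.eval_dvd (x := exp (Real.pi * I * z))
      (RatFunc.denom_add_dvd (Z.coeff n) (Z'.coeff n))
    rw [HahnSeries.coeff_add] at h0
    rw [h0, zero_dvd_iff, Polynomial.eval_mul] at this
    exact mul_ne_zero (hd n) (hd' n) this
  · refine ((hs τ ((le_max_left _ _).trans_lt hτ)).add
      (hs' τ ((le_max_right _ _).trans_lt hτ))).congr_fun fun n ↦ ?_
    rw [HahnSeries.coeff_add, RatFunc.eval_add _ _ (hd n) (hd' n), add_mul]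

/-- Uniqueness of Laurent expansions at the cusp. -/
lemma eq_zero_of_hasSum_exp {N : ℕ} (hN : 0 < N) {d : ℤ → ℂ} {k : ℤ} (hk : ∀ n ≤ k, d n = 0)
    {M : ℝ} (h : ∀ τ : ℂ, M < τ.im →
      HasSum (fun n : ℤ ↦ d n * exp (2 * Real.pi * I * τ * n / N)) 0) : d = 0 := by
  have hN' : (0 : ℝ) < N := by exact_mod_cast hN
  -- Dividing by w^k, with w = q^{1/N}, turns the Laurent series into a power series that vanishes
  -- near 0.
  let p := FormalMultilinearSeries.ofScalars ℂ fun m : ℕ ↦ d (k + m)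
  have hp : HasFPowerSeriesAt (fun _ : ℂ ↦ (0 : ℂ)) p 0 := by
    rw [hasFPowerSeriesAt_iff]
    have hM : ∀ᶠ w : ℂ in 𝓝[≠] 0, M < (Function.Periodic.invQParam N w).im :=
      (tendsto_comap.comp (Function.Periodic.invQParam_tendsto hN')).eventually_gt_atTop M
    filter_upwards [eventually_nhdsWithin_iff.mp hM] with w hw
    simp only [p, FormalMultilinearSeries.coeff_ofScalars, smul_eq_mul]
    -- At the centre, not reached by any τ, only the constant term d k survives; it is zero by `hk`.
    by_cases hw0 : w = 0
    · convert hasSum_zero with m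
      rcases Nat.eq_zero_or_pos m with rfl | hm
      · rw [Nat.cast_zero, add_zero, hk k le_rfl, mul_zero]
      · rw [hw0, zero_pow hm.ne', zero_mul]
    have hs := h _ (hw hw0)
    have hexp : exp (2 * Real.pi * I * Function.Periodic.invQParam N w / N) = w :=
      Function.Periodic.qParam_right_inv hN'.ne' hw0
    have hinj : Function.Injective fun m : ℕ ↦ k + m := fun a b hab ↦ by simpa using hab
    rw [← hinj.hasSum_iff] at hs
    · have := hs.mul_left (w ^ (-k))
      rw [mul_zero] at this
      refine this.congr_fun fun m ↦ ?_
      have hE : exp (2 * Real.pi * I * Function.Periodic.invQParam N w * ((k + m : ℤ) : ℂ) / N) =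
          w ^ (k + m : ℤ) := by
        rw [← hexp, ← exp_int_mul, hexp]
        ring_nf
      rw [Function.comp_apply, hE, zpow_add₀ hw0, zpow_neg, zpow_natCast]
      field_simp [zpow_ne_zero k hw0]
    · intro n hn
      rw [hk n, zero_mul]
      by_contra! hlt
      exact hn ⟨(n - k).toNat, by simp only; omega⟩
  have hp0 := hp.eq_zero
  funext n
  rcases le_or_gt n k with hn | hn
  · exact hk n hn
  · have := congrArg (fun q ↦ FormalMultilinearSeries.coeff q (n - k).toNat) hp0
    simp only [p, FormalMultilinearSeries.coeff_ofScalars] at this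
    rw [show k + ((n - k).toNat : ℤ) = n by omega] at this
    exact this

lemma ratFunc_eq_of_infinite {x y : RatFunc ℂ} {S : Set ℂ} (hS : S.Infinite)
    (hx : ∀ a ∈ S, x.denom.eval a ≠ 0) (hy : ∀ a ∈ S, y.denom.eval a ≠ 0)
    (h : ∀ a ∈ S, x.eval (RingHom.id ℂ) a = y.eval (RingHom.id ℂ) a) : x = y := by
  have hp : x.num * y.denom = y.num * x.denom :=
    Polynomial.eq_of_infinite_eval_eq _ _ <| hS.mono fun a ha ↦ by
      have := h a ha
      rw [RatFunc.eval, RatFunc.eval, Polynomial.eval₂_id, Polynomial.eval₂_id,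
        Polynomial.eval₂_id, Polynomial.eval₂_id, div_eq_div_iff (hx a ha) (hy a ha)] at this
      simpa using this
  rw [← RatFunc.num_div_denom x, ← RatFunc.num_div_denom y, div_eq_div_iff
    (RatFunc.algebraMap_ne_zero x.denom_ne_zero) (RatFunc.algebraMap_ne_zero y.denom_ne_zero),
    ← map_mul, ← map_mul, hp]

/-- A codiscrete set is open and nonempty, and z ↦ e^{πiz} is an open map. -/
lemma infinite_image_exp_of_mem_codiscrete {S : Set ℂ} (hS : S ∈ codiscrete ℂ) :
    ((fun z ↦ exp (Real.pi * I * z)) '' S).Infinite := by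
  have hpi : (Real.pi * I : ℂ) ≠ 0 := mul_ne_zero (by exact_mod_cast Real.pi_ne_zero) I_ne_zero
  have hmap : IsOpenMap fun z : ℂ ↦ exp (Real.pi * I * z) :=
    isOpenMap_exp.comp (Homeomorph.mulLeft₀ _ hpi).isOpenMap
  have h0 : S ∈ 𝓝[≠] (0 : ℂ) := by simpa using mem_codiscrete.mp hS 0
  obtain ⟨z, hz⟩ := nonempty_of_mem h0
  exact infinite_of_mem_nhds _ ((hmap S (mem_codiscrete'.mp hS).1).mem_nhds (Set.mem_image_of_mem _ hz))

/-- For generic z the evaluated coefficients agree by uniqueness of Laurent expansions in q^{1/N};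
rational functions agreeing at infinitely many y^{1/2} are equal. -/
lemma IsFourierExpansion.unique {N : ℕ} (hN : 0 < N) {Z Z' : QYSeries} {F : ℂ → ℂ → ℂ}
    (h : IsFourierExpansion N Z F) (h' : IsFourierExpansion N Z' F) : Z = Z' := by
  have hS := infinite_image_exp_of_mem_codiscrete (h.and h')
  ext n
  refine ratFunc_eq_of_infinite hS ?_ ?_ ?_
  · rintro _ ⟨z, hz, rfl⟩
    exact hz.1.1 n
  · rintro _ ⟨z, hz, rfl⟩
    exact hz.2.1 n
  · rintro _ ⟨z, ⟨⟨-, M, -, hs⟩, -, M', -, hs'⟩, rfl⟩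
    have h0 := eq_zero_of_hasSum_exp hN (d := fun n ↦
      RatFunc.eval (RingHom.id ℂ) (exp (Real.pi * I * z)) (Z.coeff n) -
        RatFunc.eval (RingHom.id ℂ) (exp (Real.pi * I * z)) (Z'.coeff n))
      (k := min Z.order Z'.order - 1) (M := max M M') (fun n hn ↦ by
        rw [HahnSeries.coeff_eq_zero_of_lt_order, HahnSeries.coeff_eq_zero_of_lt_order, sub_self]
        <;> omega) fun τ hτ ↦ by
        simpa only [sub_mul, sub_self] using (hs τ ((le_max_left _ _).trans_lt hτ)).sub
          (hs' τ ((le_max_right _ _).trans_lt hτ))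
    exact sub_eq_zero.mp (congrFun h0 n)

variable {L : Type*} [AddCommGroup L] {B : LinearMap.BilinForm ℤ L}

lemma k3Total_congr (he : ∀ x : L, Even (B x x)) (hs : ∀ x y : L, B x y = B y x) (r : ℕ)
    [NeZero r] {c c' : L} (h : c - c' ∈ multiples L r) : k3Total r B c = k3Total r B c' := by
  funext τ z
  rw [k3Total_eq he, k3Total_eq he, k3Reduced_congr he hs h]

end Fourier
end RefinedVW

theorem mainTheorem5 {L : Type*} [AddCommGroup L] [Module.Free ℤ L] [Module.Finite ℤ L]
    (B : LinearMap.BilinForm ℤ L) (hB : RefinedVW.IsK3Lattice B) (r : ℕ) (hr : r.Prime) :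
    -- the formulas only depend on the class of `c₁` modulo `r`
    (∀ c₁ c₁' : L, c₁ - c₁' ∈ RefinedVW.multiples L r →
      RefinedVW.k3Total r B c₁ = RefinedVW.k3Total r B c₁') ∧
    -- the formulas satisfy the refined modular transformations for `χ = 2`, `K² = 0`, `e = 24`
    RefinedVW.RefinedModular r 2 0 24 B (RefinedVW.k3Total r B) ∧
    -- explicit form of the two transformations, away from the polar locus
    (∀ (c₁ : L) (τ z : ℂ), 0 < τ.im → (∀ k l : ℤ, (r : ℂ) * z ≠ k + l * τ) →
      RefinedVW.k3Total r B c₁ (τ + 1) z =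
        Complex.exp (-(Complex.I * Real.pi * (r - 1) / r * B c₁ c₁)) *
          RefinedVW.k3Total r B c₁ τ z ∧
      RefinedVW.k3Total r B c₁ (-1 / τ) (z / τ) / RefinedVW.yDiff (z / τ) ^ 2 =
        (r : ℂ) ^ (-11 : ℤ) * τ ^ (-10 : ℤ) *
          Complex.exp (-(2 * Real.pi * Complex.I * z ^ 2 / τ * r)) *
          ∑ᶠ a : L ⧸ RefinedVW.multiples L r,
            Complex.exp (2 * Real.pi * Complex.I / r * B c₁ a.out) *
              (RefinedVW.k3Total r B a.out τ z / RefinedVW.yDiff z ^ 2)) ∧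
    -- the K3 conjecture implies the refined modularity conjecture
    (∀ Zinst Zmono : L → RefinedVW.QYSeries, RefinedVW.K3Conj r B Zinst Zmono →
      RefinedVW.RefinedModularityConj r 2 0 24 B (fun c₁ => Zinst c₁ + Zmono c₁)) := by
  have := Fact.mk hr
  have hcongr := fun c c' ↦ RefinedVW.k3Total_congr hB.even hB.symm r (c := c) (c' := c')
  have hmod := RefinedVW.refinedModular_k3Total hB r
  refine ⟨hcongr, hmod, fun c τ z hτ hz ↦ ⟨RefinedVW.k3Total_add_one hB.even r c τ z,
    RefinedVW.k3Total_S hB r c hτ (RefinedVW.yDiff_ne_zero_of_mul hz)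
      (RefinedVW.yDiff_div_ne_zero_of_mul hτ hz)⟩, fun Zinst Zmono hZ ↦ ?_⟩
  have hexp : ∀ c, RefinedVW.IsFourierExpansion (24 * r) (Zinst c + Zmono c)
      (RefinedVW.k3Total r B c) := fun c ↦ (hZ c).1.add (hZ c).2
  refine ⟨fun c c' h ↦ ?_, RefinedVW.k3Total r B, hexp, hmod⟩
  -- Both series expand the same function, since congruent classes give equal functions.
  exact (hexp c).unique (Nat.mul_pos (by norm_num) hr.pos) (hcongr c c' h ▸ hexp c')
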